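/- Let $p$ be a prime, $W=W(\overline{\mathbb F}_p)$ the ring of Witt vectors with Frobenius $F$, and $K=\operatorname{Frac}W$. For $a\in\mathbb Z_p$ and $m\ge 0$ let $(a)_m=a(a+1)\cdots(a+m-1)$ be the Pochhammer symbol; the Dwork prime of $a$ is $a'=(a+l)/p$, where $l\in\{0,\dots,p-1\}$ and $a+l\equiv 0 \bmod p$; put $a^{(0)}=a$ and $a^{(i)}=(a^{(i-1)})'$. For an integer $s\ge 1$ (the number of parameters) put $$F_{a,\dots,a}(t)=\sum_{k\ge 0}\Big(\frac{(a)_k}{k!}\Big)^s t^k\in \mathbb Z_p[[t]],$$ and write $f(t)_{<m}$ for the truncation of a power series to degrees $<m$. Let $c=1+pu$ with $u\in W$, put $c^\alpha=\sum_{i\ge 0}\binom{\alpha}{i}p^iu^i$ for $\alpha\in\mathbb Z_p$, and let $\sigma$ be the Frobenius with $\sigma(t)=ct^p$, acting on formal sums of symbols $t^\alpha$ $(\alpha\in\mathbb Z_p)$ with coefficients in $W$ by $\big(\sum x_\alpha t^\alpha\big)^\sigma=\sum x_\alpha^F c^{\alpha}t^{p\alpha}$; let $\int_0^t(-)\frac{dt}{t}$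 be the operator $t^\alpha\mapsto t^\alpha/\alpha$ $(\alpha\ne 0)$. Let $q=4$ if $p=2$ and $q=p$ otherwise, let $l'\in\{0,\dots,q-1\}$ with $a+l'\equiv 0\bmod q$, and $e=l'-\lfloor l'/p\rfloor$. For $a\in\mathbb Z_p\setminus\mathbb Z_{\le 0}$ define $$\widehat G^{(\sigma)}_{a,\dots,a}(t)=t^{-a}\int_0^t\Big(t^aF_{a,\dots,a}(t)-(-1)^{se}\big[t^{a'}F_{a',\dots,a'}(t)\big]^\sigma\Big)\frac{dt}{t},\qquad \widehat{\mathscr F}^{(\sigma)}_{a,\dots,a}(t)=\frac{\widehat G^{(\sigma)}_{a,\dots,a}(t)}{F_{a,\dots,a}(t)}\in K[[t]].$$ Let $a\in\mathbb Z_p\setminus\mathbb Z_{\le 0}$ and suppose that $a^{(r)}=a$ for some $r>0$. Put $h(t)=\prod_{i=0}^{r-1}F_{a^{(i)},\dots,a^{(i)}}(t)_{<p}$. Then $\widehat{\mathscr F}^{(\sigma)}_{a,\dots,a}(t)$ has coefficients in $W$ and lies in $$W\langle t,t^{-1},h(t)^{-1}\rangle:=\varprojlim_n\,(W/p^n)[t,t^{-1},h(t)^{-1}],$$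 that is, there is a unique element of this ring whose expansion at $t=0$, in $\varprojlim_n (W/p^n)((t))$, is $\widehat{\mathscr F}^{(\sigma)}_{a,\dots,a}(t)$. In particular $\widehat{\mathscr F}^{(\sigma)}_{a,\dots,a}(t)$ is $p$-adically analytic (convergent) in the sense of Krasner: for every ring homomorphism $\varphi:W\to\mathbb C_p$ with $|\varphi(w)|\le 1$ for all $w\in W$, through which elements of $W$ are regarded as elements of $\mathbb C_p$, there is a function on $\{x\in\mathbb C_p: |x|\le 1,\ |h(x)|=1\}$ that is a uniform limit of rational functions over $\mathbb C_p$ without poles in this set and that is equal to the sum of the power series $\widehat{\mathscr F}^{(\sigma)}_{a,\dots,a}(x)$ for all $|x|<1$. -/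

import Mathlib

open Polynomial

noncomputable section

namespace HatHG

/-- The Witt ring `W = W(𝔽̄_p)`. -/
abbrev W (p : ℕ) [Fact p.Prime] : Type := WittVector p (AlgebraicClosure (ZMod p))

/-- `K = Frac W`. -/
abbrev K (p : ℕ) [Fact p.Prime] : Type := FractionRing (W p)

variable {p : ℕ} [Fact p.Prime]

/-- The inclusion `ℤ_p = W(𝔽_p) → W`. -/
def zpToW : ℤ_[p] →+* W p :=
  (WittVector.map (algebraMap (ZMod p) (AlgebraicClosure (ZMod p)))).comp
    (WittVector.equiv p).symm.toRingHom

/-! ### Dwork primes and the sign exponent -/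

/-- The integer `l ∈ {0, …, p ^ m - 1}` with `a + l ≡ 0 mod p ^ m`. -/
def negRes (m : ℕ) (a : ℤ_[p]) : ℕ := (PadicInt.toZModPow m (-a)).val

theorem pow_dvd_add_negRes (m : ℕ) (a : ℤ_[p]) :
    (p : ℤ_[p]) ^ m ∣ a + (negRes m a : ℤ_[p]) := by
  have : NeZero (p ^ m) := ⟨pow_ne_zero _ (Fact.out : p.Prime).ne_zero⟩
  rw [← Ideal.mem_span_singleton, ← PadicInt.ker_toZModPow, RingHom.mem_ker, map_add, map_natCast,
    negRes, ZMod.natCast_zmod_val, map_neg, add_neg_cancel]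

theorem dvd_add_negRes_one (a : ℤ_[p]) : (p : ℤ_[p]) ∣ a + (negRes 1 a : ℤ_[p]) := by
  simpa using pow_dvd_add_negRes 1 a

/-- The Dwork prime `a' = (a + l) / p`, where `l ∈ {0, …, p - 1}` and `a + l ≡ 0 mod p`.
The `r`-th Dwork prime of `a` is `dworkPrime^[r] a`. -/
def dworkPrime (a : ℤ_[p]) : ℤ_[p] := (dvd_add_negRes_one a).choose

theorem p_mul_dworkPrime (a : ℤ_[p]) :
    (p : ℤ_[p]) * dworkPrime a = a + (negRes 1 a : ℤ_[p]) :=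
  (dvd_add_negRes_one a).choose_spec.symm

/-- `e = l' - ⌊l' / p⌋`, where `l' ∈ {0, …, q - 1}` and `a + l' ≡ 0 mod q`, with `q = 4` if
`p = 2` and `q = p` otherwise. -/
def signExp (a : ℤ_[p]) : ℕ :=
  negRes (if p = 2 then 2 else 1) a - negRes (if p = 2 then 2 else 1) a / p

/-! ### The hypergeometric series and its truncations -/

/-- The hypergeometric series `F_{a,…,a}(t) = ∑ ((a)_k / k!) ^ s t ^ k`, with `s` parameters `a`.
Here `Ring.multichoose a k = (a)_k / k! = a (a + 1) ⋯ (a + k - 1) / k!`, an element of `ℤ_p`. -/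
def hyp (s : ℕ) (a : ℤ_[p]) : PowerSeries (W p) :=
  PowerSeries.mk fun k => zpToW (Ring.multichoose a k) ^ s

/-- `h(t) = ∏_{i < r} F_{a^{(i)},…,a^{(i)}}(t)_{< p}`. -/
def hPoly (s r : ℕ) (a : ℤ_[p]) : (W p)[X] :=
  ∏ i ∈ Finset.range r, PowerSeries.trunc p (hyp s (dworkPrime^[i] a))

theorem hPoly_coeff_zero (s r : ℕ) (a : ℤ_[p]) : IsUnit ((hPoly s r a).coeff 0) := by
  have h0 : (hPoly s r a).coeff 0 = 1 := by
    rw [hPoly, Polynomial.coeff_zero_prod]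
    refine Finset.prod_eq_one fun i _ => ?_
    rw [PowerSeries.coeff_trunc, if_pos (Fact.out : p.Prime).pos, hyp, PowerSeries.coeff_mk,
      Ring.multichoose_zero_right, map_one, one_pow]
  rw [h0]
  exact isUnit_one

/-! ### The function `F̂^{(σ)}_{a,…,a}(t)` -/

/-- Partial sums of the binomial series `∑ binom(α, i) p ^ i u ^ i`. -/
def binomPartial (u : W p) (α : ℤ_[p]) (n : ℕ) : W p :=
  ∑ i ∈ Finset.range n, zpToW (Ring.choose α i) * (p : W p) ^ i * u ^ i

theorem exists_binomLimit (u : W p) (α : ℤ_[p]) :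
    ∃ L : W p, ∀ n, (p : W p) ^ n ∣ L - binomPartial u α n := by
  have key : ∀ m n, m ≤ n → (p : W p) ^ m ∣ binomPartial u α n - binomPartial u α m := by
    intro m n hmn
    rw [binomPartial, binomPartial, ← Finset.sum_range_add_sum_Ico _ hmn, add_sub_cancel_left]
    refine Finset.dvd_sum fun i hi => ?_
    exact Dvd.dvd.mul_right (Dvd.dvd.mul_left (pow_dvd_pow _ (Finset.mem_Ico.mp hi).1) _) _
  have hI : ∀ (n : ℕ) (x y : W p),
      x ≡ y [SMOD ((Ideal.span {(p : W p)}) ^ n • ⊤ : Submodule (W p) (W p))] ↔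
        (p : W p) ^ n ∣ y - x := by
    intro n x y
    rw [SModEq.comm, SModEq.sub_mem, smul_eq_mul, Ideal.mul_top, Ideal.span_singleton_pow,
      Ideal.mem_span_singleton]
  obtain ⟨L, hL⟩ := (WittVector.isAdicCompleteIdealSpanP (p := p)
    (k := AlgebraicClosure (ZMod p))).toIsPrecomplete.prec' (binomPartial u α)
    (fun {m n} hmn => (hI m _ _).2 (key m n hmn))
  exact ⟨L, fun n => (hI n _ _).1 (hL n)⟩

/-- `c ^ α = ∑ binom(α, i) p ^ i u ^ i` for `c = 1 + p u` and `α ∈ ℤ_p`, the `p`-adic sum. -/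
def onePlusPow (u : W p) (α : ℤ_[p]) : W p := (exists_binomLimit u α).choose

/-- Formal sums `∑_{α ∈ ℤ_p} x_α t ^ α` in the symbols `t ^ α`, given by their coefficients. -/
abbrev FormalSum (p : ℕ) [Fact p.Prime] (R : Type) : Type := ℤ_[p] → R

/-- The formal sum `t ^ a G(t)`. -/
def tPowMul (a : ℤ_[p]) (G : PowerSeries (W p)) : FormalSum p (W p) :=
  Function.extend (fun k : ℕ => a + (k : ℤ_[p])) (fun k => PowerSeries.coeff k G) 0

/-- The Frobenius `σ` with `σ(t) = c t ^ p`, where `c = 1 + p u`, on formal sums: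
`(∑ x_α t ^ α)^σ = ∑ x_α^F c ^ α t ^ (p α)`, with `F` the Frobenius of `W`. -/
def sigma (u : W p) (f : FormalSum p (W p)) : FormalSum p (W p) :=
  Function.extend (fun α : ℤ_[p] => (p : ℤ_[p]) * α)
    (fun α => WittVector.frobenius (f α) * onePlusPow u α) 0

/-- The operator `∫_0^t (-) dt/t`, with `t ^ α ↦ t ^ α / α`. -/
def intDtOverT (f : FormalSum p (W p)) : FormalSum p (K p) :=
  fun α => algebraMap (W p) (K p) (f α) / algebraMap (W p) (K p) (zpToW α)

/-- The power series
`Ĝ^{(σ)}_{a,…,a}(t) = t ^ (-a) ∫_0^t (t ^ a F_{a,…,a}(t) - (-1) ^ (s e) [t ^ a' F_{a',…,a'}(t)]^σ) dt/t`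
for `σ(t) = (1 + p u) t ^ p`: its `k`-th coefficient is that of `t ^ (a + k)` in the integral. -/
def hatG (s : ℕ) (a : ℤ_[p]) (u : W p) : PowerSeries (K p) :=
  PowerSeries.mk fun k =>
    intDtOverT
      (tPowMul a (hyp s a)
        - (-1 : W p) ^ (s * signExp a) • sigma u (tPowMul (dworkPrime a) (hyp s (dworkPrime a))))
      (a + (k : ℤ_[p]))

/-- `F̂^{(σ)}_{a,…,a}(t) = Ĝ^{(σ)}_{a,…,a}(t) / F_{a,…,a}(t)` for `σ(t) = (1 + p u) t ^ p`. -/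
def hatF (s : ℕ) (a : ℤ_[p]) (u : W p) : PowerSeries (K p) :=
  hatG s a u * ((hyp s a).map (algebraMap (W p) (K p)))⁻¹

/-! ### The ring `W⟨t, t⁻¹, h(t)⁻¹⟩` -/

/-- `W / p ^ n`. -/
abbrev Wmod (p : ℕ) [Fact p.Prime] (n : ℕ) : Type := W p ⧸ Ideal.span {(p : W p) ^ n}

/-- The reduction `W / p ^ n → W / p ^ m` for `m ≤ n`. -/
def red {m n : ℕ} (hmn : m ≤ n) : Wmod p n →+* Wmod p m :=
  Ideal.Quotient.factor
    (Ideal.span_singleton_le_span_singleton.2 (pow_dvd_pow (p : W p) hmn))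

/-- The image of `t h(t)` in `(W / p ^ n)[t]`. -/
def den (h : (W p)[X]) (n : ℕ) : (Wmod p n)[X] :=
  (X * h).map (Ideal.Quotient.mk (Ideal.span {(p : W p) ^ n}))

/-- `(W / p ^ n)[t, t⁻¹, h(t)⁻¹]`. -/
abbrev Level (h : (W p)[X]) (n : ℕ) : Type := Localization.Away (den h n)

theorem map_den (h : (W p)[X]) {m n : ℕ} (hmn : m ≤ n) :
    (den h n).map (red hmn) = den h m := by
  rw [den, den, Polynomial.map_map]
  congr 1

/-- The transition map `(W / p ^ n)[t, t⁻¹, h(t)⁻¹] → (W / p ^ m)[t, t⁻¹, h(t)⁻¹]`, `m ≤ n`. -/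
def trans (h : (W p)[X]) {m n : ℕ} (hmn : m ≤ n) : Level h n →+* Level h m :=
  IsLocalization.Away.lift (den h n)
    (g := (algebraMap (Wmod p m)[X] (Level h m)).comp (Polynomial.mapRingHom (red hmn)))
    (by
      rw [RingHom.comp_apply, Polynomial.coe_mapRingHom, map_den]
      exact IsLocalization.Away.algebraMap_isUnit (den h m))

/-- `W⟨t, t⁻¹, h(t)⁻¹⟩ = lim_n (W / p ^ n)[t, t⁻¹, h(t)⁻¹]`. -/
def TateRing (h : (W p)[X]) : Subring (∀ n, Level h n) where
  carrier := {x | ∀ (m n : ℕ) (hmn : m ≤ n), trans h hmn (x n) = x m}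
  mul_mem' := fun hx hy m n hmn => by
    rw [Pi.mul_apply, Pi.mul_apply, map_mul, hx m n hmn, hy m n hmn]
  one_mem' := fun m n hmn => by rw [Pi.one_apply, Pi.one_apply, map_one]
  add_mem' := fun hx hy m n hmn => by
    rw [Pi.add_apply, Pi.add_apply, map_add, hx m n hmn, hy m n hmn]
  zero_mem' := fun m n hmn => by rw [Pi.zero_apply, Pi.zero_apply, map_zero]
  neg_mem' := fun hx m n hmn => by rw [Pi.neg_apply, Pi.neg_apply, map_neg, hx m n hmn]

/-- Polynomials as Laurent series. -/
def polyToLaurent (R : Type) [CommRing R] : R[X] →+* LaurentSeries R :=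
  (HahnSeries.ofPowerSeries ℤ R).comp Polynomial.coeToPowerSeries.ringHom

theorem isUnit_polyToLaurent_den (h : (W p)[X]) (hh : IsUnit (h.coeff 0)) (n : ℕ) :
    IsUnit (polyToLaurent (Wmod p n) (den h n)) := by
  rw [den, Polynomial.map_mul, map_mul, Polynomial.map_X]
  refine IsUnit.mul ?_ ?_
  · refine IsUnit.of_mul_eq_one (HahnSeries.single (-1 : ℤ) (1 : Wmod p n)) ?_
    rw [polyToLaurent, RingHom.comp_apply, Polynomial.coeToPowerSeries.ringHom_apply,
      Polynomial.coe_X, HahnSeries.ofPowerSeries_X, HahnSeries.single_mul_single]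
    simp
  · rw [polyToLaurent, RingHom.comp_apply]
    refine IsUnit.map _ ?_
    rw [Polynomial.coeToPowerSeries.ringHom_apply, PowerSeries.isUnit_iff_constantCoeff,
      Polynomial.constantCoeff_coe, Polynomial.coeff_map]
    exact hh.map _

/-- The expansion `(W / p ^ n)[t, t⁻¹, h(t)⁻¹] → (W / p ^ n)((t))` at `t = 0`, which exists as
`h(0)` is a unit. -/
def expand (h : (W p)[X]) (hh : IsUnit (h.coeff 0)) (n : ℕ) :
    Level h n →+* LaurentSeries (Wmod p n) :=
  IsLocalization.Away.lift (den h n) (g := polyToLaurent (Wmod p n))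
    (isUnit_polyToLaurent_den h hh n)

/-- `x ∈ W⟨t, t⁻¹, h(t)⁻¹⟩` is the element given by the power series `f ∈ W[[t]]`: both have the
same image in `lim_n (W / p ^ n)((t))`. -/
def HasExpansion (h : (W p)[X]) (hh : IsUnit (h.coeff 0)) (x : TateRing h)
    (f : PowerSeries (W p)) : Prop :=
  ∀ n, expand h hh n (x.1 n) =
    HahnSeries.ofPowerSeries ℤ (Wmod p n)
      (f.map (Ideal.Quotient.mk (Ideal.span {(p : W p) ^ n})))

/-- `g` is analytic on `D` in the sense of Krasner: on `D` it is a uniform limit of rational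
functions without poles in `D`. -/
def IsKrasnerAnalyticOn {L : Type} [NormedField L] (g : L → L) (D : Set L) : Prop :=
  ∀ ε : ℝ, 0 < ε → ∃ P Q : L[X],
    (∀ x ∈ D, Q.eval x ≠ 0) ∧ ∀ x ∈ D, ‖g x - P.eval x / Q.eval x‖ ≤ ε

end HatHG

end

noncomputable section

namespace HatHG

section

/-! ### `p`-adically uniformly continuous sequences -/

/-! Put A_i(k) = ((a^(i))_k / k!)^s and F_i = ∑ A_i(k) t^k. Two facts carry the theorem. The k-th
coefficient of Ĝ is q(k) A_0(k) with q : ℕ → W p-adically uniformly continuous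
(`exists_padicUC_hatG`). For every uniformly continuous c, the quotient (∑ c(k) A_i(k) t^k) / F_i is
modulo each p^n of the form P / h^m with P a polynomial (`IsDworkFamily.ratio_mem`). Taking c = q
gives F̂ (`exists_hatF`); the element of the Tate ring and the Krasner analytic function are then
formal consequences.

For the second fact, A_i(k + pj) = A_{i+1}(j) (A_i(k) + p e_k(j)) for k < p, with e_k uniformly
continuous (`exists_multichoose_pow_quot`). Splitting by residues mod p writes ∑ c(k) A_i(k) t^k as
F_{i+1}(t^p) times a combination of quotients of the same kind for i + 1. The e_k terms carry a
factor p, so they are known mod p^(n+1) by induction on n. For c = 1 this makes F_i / F_{i+1}(t^p)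
rational; mod p it is the truncation of F_i, a divisor of h, so its inverse is rational too. Hence c
may be replaced by the functions j ↦ c(k + pj). A c of period p^M becomes constant after M such
steps, and any c is periodic mod p^(n+1).

For the first fact, q(k) = 1/(a + k) if p ∤ a + k. Otherwise a + k = x = p(a' + j), and w^s -
(-1)^(se) c^(a'+j) has to be divided by x, where w = ((a)_k / k!) / ((a')_j / j!). Reversing the
product gives w = ± ∏ (1 - x/i) over i ≤ k prime to p. This product and c^(a'+j) are both 1 + x ·
(uniformly continuous), and e is such that the signs agree modulo x (`exists_padicUC_quot`). -/

/-- The sequence `c` is uniformly continuous for the `p`-adic topologies on `ℕ` and `R`. -/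
def PadicUC {R : Type*} [CommRing R] (p : ℕ) (c : ℕ → R) : Prop :=
  ∀ n, ∃ M, ∀ i j, i ≡ j [MOD p ^ M] → (p : R) ^ n ∣ c i - c j

namespace PadicUC

variable {R S : Type*} [CommRing R] [CommRing S] {p : ℕ} {c d : ℕ → R}

theorem const (x : R) : PadicUC p fun _ => x := fun _ => ⟨0, fun _ _ _ => by simp⟩

theorem add (hc : PadicUC p c) (hd : PadicUC p d) : PadicUC p fun j => c j + d j := fun n => by
  obtain ⟨M, hM⟩ := hc n
  obtain ⟨N, hN⟩ := hd n
  refine ⟨max M N, fun i j h => ?_⟩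
  have := dvd_add (hM i j (h.of_dvd (pow_dvd_pow _ (le_max_left _ _))))
    (hN i j (h.of_dvd (pow_dvd_pow _ (le_max_right _ _))))
  convert this using 1
  ring

theorem mul (hc : PadicUC p c) (hd : PadicUC p d) : PadicUC p fun j => c j * d j := fun n => by
  obtain ⟨M, hM⟩ := hc n
  obtain ⟨N, hN⟩ := hd n
  refine ⟨max M N, fun i j h => ?_⟩
  have := dvd_add
    ((hM i j (h.of_dvd (pow_dvd_pow _ (le_max_left _ _)))).mul_right (d i))
    ((hN i j (h.of_dvd (pow_dvd_pow _ (le_max_right _ _)))).mul_left (c j))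
  convert this using 1
  ring

theorem neg (hc : PadicUC p c) : PadicUC p fun j => -c j := by
  simpa using (const (p := p) (-1 : R)).mul hc

theorem sub (hc : PadicUC p c) (hd : PadicUC p d) : PadicUC p fun j => c j - d j := by
  simpa [sub_eq_add_neg] using hc.add hd.neg

theorem pow (hc : PadicUC p c) (s : ℕ) : PadicUC p fun j => c j ^ s := by
  induction s with
  | zero => simpa using const (p := p) (1 : R)
  | succ s ih => simpa [pow_succ] using ih.mul hc

theorem sum {ι : Type*} (s : Finset ι) {c : ι → ℕ → R} (h : ∀ i ∈ s, PadicUC p (c i)) :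
    PadicUC p fun j => ∑ i ∈ s, c i j := by
  classical
  induction s using Finset.induction_on with
  | empty => simpa using const (p := p) (0 : R)
  | insert a s ha ih =>
    simp only [Finset.sum_insert ha]
    exact (h a (Finset.mem_insert_self _ _)).add
      (ih fun i hi => h i (Finset.mem_insert_of_mem hi))

theorem map (f : R →+* S) (hc : PadicUC p c) : PadicUC p fun j => f (c j) := fun n => by
  obtain ⟨M, hM⟩ := hc n
  refine ⟨M, fun i j h => ?_⟩
  simpa using map_dvd f (hM i j h)

/-- A sequence inverse to a uniformly continuous one is uniformly continuous. -/
theorem of_mul_eq_one (hc : PadicUC p c) (h : ∀ j, c j * d j = 1) : PadicUC p d := fun n => by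
  obtain ⟨M, hM⟩ := hc n
  refine ⟨M, fun i j hij => ?_⟩
  have := (hM i j hij).mul_left (-(d i * d j))
  convert this using 1
  linear_combination d j * h i - d i * h j

theorem natCast : PadicUC p fun j => (j : R) := fun n =>
  ⟨n, fun i j h => by
    have := map_dvd (Int.castRingHom R) (Nat.modEq_iff_dvd.1 h.symm)
    simpa using this⟩

/-- Uniform continuity along an arithmetic progression. -/
theorem comp_add_mul (hc : PadicUC p c) (k m : ℕ) : PadicUC p fun j => c (k + m * j) := fun n => by
  obtain ⟨M, hM⟩ := hc n
  exact ⟨M, fun i j h => hM _ _ (Nat.ModEq.add_left _ (h.mul_left _))⟩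

/-- A multiple of a uniformly continuous sequence by `p` determines a uniformly continuous one. -/
theorem of_p_mul [IsDomain R] (hp : (p : R) ≠ 0) (hc : PadicUC p fun j => (p : R) * c j) :
    PadicUC p c := fun n => by
  obtain ⟨M, hM⟩ := hc (n + 1)
  refine ⟨M, fun i j h => ?_⟩
  have := hM i j h
  rw [pow_succ', ← mul_sub] at this
  exact (mul_dvd_mul_iff_left hp).1 this

/-- It suffices to compare `c (k + p ^ M)` with `c k`. -/
theorem of_step (h : ∀ n, ∃ M, ∀ k, (p : R) ^ n ∣ c (k + p ^ M) - c k) : PadicUC p c := fun n => by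
  obtain ⟨M, hM⟩ := h n
  have key : ∀ x k, (p : R) ^ n ∣ c (k + p ^ M * x) - c k := by
    intro x k
    induction x with
    | zero => simp
    | succ x ih =>
      have := dvd_add (hM (k + p ^ M * x)) ih
      rw [mul_add, mul_one, ← add_assoc]
      simpa using this
  have key2 : ∀ i j, i ≤ j → i ≡ j [MOD p ^ M] → (p : R) ^ n ∣ c j - c i := by
    intro i j hij h
    obtain ⟨x, hx⟩ := (Nat.modEq_iff_dvd' hij).1 h
    obtain rfl : j = i + p ^ M * x := by omega
    exact key x i
  refine ⟨M, fun i j hij => ?_⟩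
  rcases le_total i j with h | h
  · rw [← dvd_neg, neg_sub]
    exact key2 i j h hij
  · exact key2 j i h hij.symm

/-- Uniform continuity can be checked on the residue classes modulo `p`. -/
theorem of_residues (hp : 0 < p) (h : ∀ k < p, PadicUC p fun j => c (k + p * j)) : PadicUC p c := by
  intro n
  have h' : ∀ k : ℕ, ∃ M, k < p → ∀ i j, i ≡ j [MOD p ^ M] →
      (p : R) ^ n ∣ c (k + p * i) - c (k + p * j) := by
    intro k
    by_cases hk : k < p
    · obtain ⟨M, hM⟩ := h k hk n
      exact ⟨M, fun _ => hM⟩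
    · exact ⟨0, fun h => absurd h hk⟩
  choose M hM using h'
  refine ⟨(Finset.range p).sup M + 1, fun i j hij => ?_⟩
  have hmod : i % p = j % p := hij.of_dvd (dvd_pow_self p (Nat.succ_ne_zero _))
  have hlt := Nat.mod_lt i hp
  have hle : M (i % p) ≤ (Finset.range p).sup M := Finset.le_sup (Finset.mem_range.2 hlt)
  have hdiv : i / p ≡ j / p [MOD p ^ (Finset.range p).sup M] := by
    have h1 : i % p + p * (i / p) ≡ i % p + p * (j / p) [MOD p * p ^ (Finset.range p).sup M] := by
      rw [Nat.mod_add_div, hmod, Nat.mod_add_div, ← pow_succ']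
      exact hij
    exact Nat.ModEq.mul_left_cancel' hp.ne' (Nat.ModEq.add_left_cancel' _ h1)
  have := hM (i % p) hlt _ _ (hdiv.of_dvd (pow_dvd_pow _ hle))
  rwa [Nat.mod_add_div, hmod, Nat.mod_add_div] at this

end PadicUC

/-! ### Power series that are rational modulo `p ^ n` -/

variable {R : Type*} [CommRing R]

/-- The power series that agree modulo `p ^ n` with some `P / h ^ k`, `P` a polynomial. -/
def ratSubring (p : ℕ) (h : R[X]) (n : ℕ) : Subring (PowerSeries R) where
  carrier := {g | ∃ (P : R[X]) (k : ℕ),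
    (p : PowerSeries R) ^ n ∣ g * (h : PowerSeries R) ^ k - (P : PowerSeries R)}
  mul_mem' := by
    rintro f g ⟨P, k, hP⟩ ⟨Q, m, hQ⟩
    refine ⟨P * Q, k + m, ?_⟩
    have := dvd_add (hP.mul_right (g * (h : PowerSeries R) ^ m)) (hQ.mul_left (P : PowerSeries R))
    convert this using 1
    push_cast
    ring
  one_mem' := ⟨1, 0, by simp⟩
  add_mem' := by
    rintro f g ⟨P, k, hP⟩ ⟨Q, m, hQ⟩
    refine ⟨P * h ^ m + Q * h ^ k, k + m, ?_⟩
    have := dvd_add (hP.mul_right ((h : PowerSeries R) ^ m)) (hQ.mul_right ((h : PowerSeries R) ^ k))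
    convert this using 1
    push_cast
    ring
  zero_mem' := ⟨0, 0, by simp⟩
  neg_mem' := by
    rintro f ⟨P, k, hP⟩
    refine ⟨-P, k, ?_⟩
    have := dvd_neg.2 hP
    convert this using 1
    push_cast
    ring

section ratSubring

variable {p : ℕ} {h : R[X]} {n : ℕ} {f g : PowerSeries R}

theorem mem_ratSubring : g ∈ ratSubring p h n ↔ ∃ (P : R[X]) (k : ℕ),
    (p : PowerSeries R) ^ n ∣ g * (h : PowerSeries R) ^ k - (P : PowerSeries R) := Iff.rfl

theorem coe_mem_ratSubring (P : R[X]) : (P : PowerSeries R) ∈ ratSubring p h n :=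
  ⟨P, 0, by simp⟩

theorem C_mem_ratSubring (x : R) : PowerSeries.C x ∈ ratSubring p h n := by
  simpa using coe_mem_ratSubring (p := p) (h := h) (n := n) (Polynomial.C x)

theorem X_pow_mem_ratSubring (k : ℕ) : (PowerSeries.X : PowerSeries R) ^ k ∈ ratSubring p h n := by
  simpa using coe_mem_ratSubring (p := p) (h := h) (n := n) (Polynomial.X ^ k)

theorem mem_ratSubring_of_dvd_sub (hg : g ∈ ratSubring p h n)
    (hfg : (p : PowerSeries R) ^ n ∣ f - g) : f ∈ ratSubring p h n := by
  obtain ⟨P, k, hP⟩ := hg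
  refine ⟨P, k, ?_⟩
  have := dvd_add (hfg.mul_right ((h : PowerSeries R) ^ k)) hP
  convert this using 1
  ring

theorem mem_ratSubring_of_mul_pow (m : ℕ)
    (hg : g * (h : PowerSeries R) ^ m ∈ ratSubring p h n) : g ∈ ratSubring p h n := by
  obtain ⟨P, k, hP⟩ := hg
  refine ⟨P, m + k, ?_⟩
  rwa [pow_add, ← mul_assoc]

/-- The factor p gains one power of precision, which is what drives the induction in `ratio_mem`. -/
theorem p_mul_mem_ratSubring (hg : g ∈ ratSubring p h n) :
    (p : PowerSeries R) * g ∈ ratSubring p h (n + 1) := by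
  obtain ⟨P, k, hP⟩ := hg
  refine ⟨(p : R[X]) * P, k, ?_⟩
  have := mul_dvd_mul_left (p : PowerSeries R) hP
  rw [← pow_succ'] at this
  have hcast : ((p : R[X]) : PowerSeries R) = p :=
    map_natCast (Polynomial.coeToPowerSeries.ringHom (R := R)) p
  convert this using 1
  rw [Polynomial.coe_mul, hcast]
  ring

/-- The inverse of a rational `g` is rational if `g` divides `h` modulo `p`. -/
theorem inv_mem_ratSubring (hg : g ∈ ratSubring p h n) (hfg : f * g = 1) (H : R[X])
    (hH : (p : PowerSeries R) ∣ g * H - h) : f ∈ ratSubring p h n := by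
  -- Since p divides z, z^n vanishes mod p^n, and the geometric sum h^n - z^n = y g H shows that h^n
  -- / g is y H up to f z^n.
  set z : PowerSeries R := (h : PowerSeries R) - g * H with hz
  have hzm : z ∈ ratSubring p h n :=
    sub_mem (coe_mem_ratSubring h) (mul_mem hg (coe_mem_ratSubring H))
  have hzp : (p : PowerSeries R) ^ n ∣ z ^ n :=
    pow_dvd_pow_of_dvd (by rw [hz, ← dvd_neg, neg_sub]; exact hH) n
  set y : PowerSeries R := ∑ i ∈ Finset.range n, (h : PowerSeries R) ^ i * z ^ (n - 1 - i) with hy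
  have hym : y ∈ ratSubring p h n :=
    sum_mem fun i _ => mul_mem (pow_mem (coe_mem_ratSubring h) _) (pow_mem hzm _)
  have hgy : y * (g * H) = (h : PowerSeries R) ^ n - z ^ n := by
    rw [← geom_sum₂_mul, hz]
    congr 1
    ring
  refine mem_ratSubring_of_mul_pow n (mem_ratSubring_of_dvd_sub
    (mul_mem hym (coe_mem_ratSubring H)) ?_)
  have : f * (h : PowerSeries R) ^ n - y * H = f * z ^ n := by
    linear_combination (-f) * hgy + y * H * hfg
  rw [this]
  exact hzp.mul_left _

theorem pow_dvd_pow_pow_sub {A : Type*} [CommRing A] {x y : A} (hxy : (p : A) ∣ x - y) (n : ℕ) :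
    (p : A) ^ (n + 1) ∣ x ^ p ^ n - y ^ p ^ n :=
  dvd_sub_pow_of_dvd_sub hxy n

theorem expand_coe (hp : p ≠ 0) (P : R[X]) :
    PowerSeries.expand p hp (P : PowerSeries R) = (Polynomial.expand R p P : R[X]) := by
  ext m
  rw [PowerSeries.coeff_expand, Polynomial.coeff_coe, Polynomial.coeff_coe,
    Polynomial.coeff_expand (Nat.pos_of_ne_zero hp)]

/-- The denominator h(t^p) can be traded for h: raising h^p ≡ h(t^p) mod p to the power p^n gives a
congruence mod p^(n+1). -/
theorem expand_mem_ratSubring (hp : p ≠ 0) (hh : (p : R[X]) ∣ h ^ p - Polynomial.expand R p h)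
    (hg : g ∈ ratSubring p h n) : PowerSeries.expand p hp g ∈ ratSubring p h n := by
  obtain ⟨P, k, hP⟩ := hg
  have h1 : (p : PowerSeries R) ^ (n + 1) ∣ ((h : PowerSeries R) ^ p) ^ p ^ n -
      (PowerSeries.expand p hp (h : PowerSeries R)) ^ p ^ n := by
    refine pow_dvd_pow_pow_sub ?_ n
    have := map_dvd (Polynomial.coeToPowerSeries.ringHom (R := R)) hh
    simpa [expand_coe] using this
  have h2 := map_dvd (PowerSeries.expand p hp (R := R)) hP
  simp only [map_pow, map_natCast, map_sub, map_mul] at h2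
  have h3 : PowerSeries.expand p hp g * (PowerSeries.expand p hp (h : PowerSeries R)) ^ k
      ∈ ratSubring p h n := by
    refine mem_ratSubring_of_dvd_sub (coe_mem_ratSubring (Polynomial.expand R p P)) ?_
    rwa [← expand_coe hp]
  -- The exponent k is padded to a multiple of p^n, where the congruence of `h1` applies.
  have h4 : PowerSeries.expand p hp g * (PowerSeries.expand p hp (h : PowerSeries R)) ^ (p ^ n * k)
      ∈ ratSubring p h n := by
    have hk : k ≤ p ^ n * k := Nat.le_mul_of_pos_left _ (pow_pos (Nat.pos_of_ne_zero hp) _)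
    obtain ⟨d, hd⟩ := Nat.exists_eq_add_of_le hk
    rw [hd, pow_add, ← mul_assoc]
    refine mul_mem h3 (pow_mem ?_ _)
    rw [expand_coe]
    exact coe_mem_ratSubring _
  refine mem_ratSubring_of_mul_pow (p * p ^ n * k) (mem_ratSubring_of_dvd_sub h4 ?_)
  rw [← mul_sub, pow_mul, pow_mul, pow_mul]
  exact (((pow_dvd_pow _ (Nat.le_succ n)).trans h1).trans (sub_dvd_pow_sub_pow _ _ _)).mul_left _

end ratSubring

end

section

/-! ### Series with coefficients of Dwork type -/

theorem mk_eq_sum_expand {R : Type*} [CommRing R] {p : ℕ} (hp : p ≠ 0) (a : ℕ → R) :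
    PowerSeries.mk a = ∑ k ∈ Finset.range p, (PowerSeries.X : PowerSeries R) ^ k *
      PowerSeries.expand p hp (PowerSeries.mk fun j => a (k + p * j)) := by
  ext m
  have hpos := Nat.pos_of_ne_zero hp
  rw [map_sum, Finset.sum_eq_single (m % p)]
  · rw [PowerSeries.coeff_X_pow_mul', if_pos (Nat.mod_le _ _), PowerSeries.coeff_expand,
      if_pos (Nat.dvd_sub_mod m), PowerSeries.coeff_mk, PowerSeries.coeff_mk,
      Nat.mul_div_cancel' (Nat.dvd_sub_mod m), Nat.add_sub_cancel' (Nat.mod_le _ _)]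
  · intro k hk hne
    rw [PowerSeries.coeff_X_pow_mul']
    split_ifs with hkm
    · rw [PowerSeries.coeff_expand, if_neg]
      intro hd
      apply hne
      have := (Nat.modEq_iff_dvd' hkm).2 hd
      rw [← this, Nat.mod_eq_of_lt (Finset.mem_range.1 hk)]
    · rfl
  · intro h
    exact absurd (Finset.mem_range.2 (Nat.mod_lt m hpos)) h

/-- A sequence of sequences `A i` with `A i (k + p j) / A (i + 1) j ≡ A i k` modulo `p` for `k < p`,
the quotient being a uniformly continuous function of `j`, whose truncations divide `h`. -/
structure IsDworkFamily {R : Type*} [CommRing R] (p : ℕ) (h : R[X]) (A : ℕ → ℕ → R) : Prop where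
  ne_zero : p ≠ 0
  zero_right : ∀ i, A i 0 = 1
  expand_dvd : (p : R[X]) ∣ h ^ p - Polynomial.expand R p h
  trunc_dvd : ∀ i, PowerSeries.trunc p (PowerSeries.mk (A i)) ∣ h
  exists_quot : ∀ i, ∀ k < p, ∃ e : ℕ → R, PadicUC p e ∧
    ∀ j, A i (k + p * j) = A (i + 1) j * (A i k + p * e j)

namespace IsDworkFamily

variable {R : Type*} [CommRing R] {p : ℕ} {h : R[X]} {A : ℕ → ℕ → R}

/-- The inverse of `∑ A i j t ^ j`. -/
def inv (A : ℕ → ℕ → R) (i : ℕ) : PowerSeries R := PowerSeries.invOfUnit (PowerSeries.mk (A i)) 1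

/-- `(∑ c j A i j t ^ j) / (∑ A i j t ^ j)`. -/
def ratio (A : ℕ → ℕ → R) (i : ℕ) (c : ℕ → R) : PowerSeries R :=
  PowerSeries.mk (fun j => c j * A i j) * inv A i

theorem mk_mul_inv (H : IsDworkFamily p h A) (i : ℕ) : PowerSeries.mk (A i) * inv A i = 1 := by
  refine PowerSeries.mul_invOfUnit _ _ ?_
  rw [← PowerSeries.coeff_zero_eq_constantCoeff_apply, PowerSeries.coeff_mk, H.zero_right,
    Units.val_one]

theorem ratio_mul (H : IsDworkFamily p h A) (i : ℕ) (c : ℕ → R) :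
    ratio A i c * PowerSeries.mk (A i) = PowerSeries.mk (fun j => c j * A i j) := by
  rw [ratio, mul_assoc, mul_comm (inv A i), H.mk_mul_inv, mul_one]

/-- `(∑ c j A i j t ^ j) / (∑ A (i + 1) j t ^ (p j))`, decomposed into residue classes. -/
def quot (hp : p ≠ 0) (A e : ℕ → ℕ → R) (i : ℕ) (c : ℕ → R) : PowerSeries R :=
  ∑ k ∈ Finset.range p, PowerSeries.X ^ k * PowerSeries.expand p hp
    (PowerSeries.C (A i k) * ratio A (i + 1) (fun j => c (k + p * j)) +
      (p : PowerSeries R) * ratio A (i + 1) (fun j => c (k + p * j) * e k j))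

/-- On each residue class k mod p the Dwork relation makes A (i + 1) j a common factor; the
denominators in `ratio` cancel against the expanded series. -/
theorem mk_eq_quot_mul (H : IsDworkFamily p h A) {i : ℕ} {e : ℕ → ℕ → R}
    (he : ∀ k < p, ∀ j, A i (k + p * j) = A (i + 1) j * (A i k + p * e k j)) (c : ℕ → R) :
    PowerSeries.mk (fun j => c j * A i j) = quot H.ne_zero A e i c *
      PowerSeries.expand p H.ne_zero (PowerSeries.mk (A (i + 1))) := by
  rw [quot, mk_eq_sum_expand H.ne_zero, Finset.sum_mul]
  refine Finset.sum_congr rfl fun k hk => ?_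
  rw [mul_assoc, ← map_mul, add_mul, mul_assoc, mul_assoc, H.ratio_mul, H.ratio_mul]
  congr 2
  ext j
  rw [map_add, PowerSeries.coeff_C_mul, ← map_natCast (PowerSeries.C (R := R)),
    PowerSeries.coeff_C_mul, PowerSeries.coeff_mk, PowerSeries.coeff_mk, PowerSeries.coeff_mk,
    he k (Finset.mem_range.1 hk)]
  ring

theorem quot_mem (H : IsDworkFamily p h A) {n i : ℕ} {e : ℕ → ℕ → R} {c : ℕ → R}
    (hc : ∀ k < p, ratio A (i + 1) (fun j => c (k + p * j)) ∈ ratSubring p h (n + 1))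
    (he : ∀ k < p, ratio A (i + 1) (fun j => c (k + p * j) * e k j) ∈ ratSubring p h n) :
    quot H.ne_zero A e i c ∈ ratSubring p h (n + 1) := by
  refine sum_mem fun k hk => mul_mem (X_pow_mem_ratSubring k) ?_
  rw [Finset.mem_range] at hk
  exact expand_mem_ratSubring H.ne_zero H.expand_dvd (add_mem
    (mul_mem (C_mem_ratSubring _) (hc k hk)) (p_mul_mem_ratSubring (he k hk)))

theorem ratio_one (H : IsDworkFamily p h A) (i : ℕ) : ratio A i (fun _ => 1) = 1 := by
  rw [ratio, ← H.mk_mul_inv i]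
  simp

/-- The ratio with weight 1 is 1, so modulo p only the terms A i k t^k with k < p survive. -/
theorem dvd_quot_one_sub (H : IsDworkFamily p h A) (i : ℕ) (e : ℕ → ℕ → R) :
    (p : PowerSeries R) ∣ quot H.ne_zero A e i (fun _ => 1) -
      (PowerSeries.trunc p (PowerSeries.mk (A i)) : R[X]) := by
  have htr : ((PowerSeries.trunc p (PowerSeries.mk (A i)) : R[X]) : PowerSeries R) =
      ∑ k ∈ Finset.range p, PowerSeries.X ^ k * PowerSeries.expand p H.ne_zero
        (PowerSeries.C (A i k)) := by
    ext m
    rw [Polynomial.coeff_coe, PowerSeries.coeff_trunc, map_sum, PowerSeries.coeff_mk]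
    simp only [PowerSeries.expand_C, mul_comm (PowerSeries.X ^ _), PowerSeries.coeff_C_mul,
      PowerSeries.coeff_X_pow]
    simp
  rw [htr, quot, ← Finset.sum_sub_distrib]
  refine Finset.dvd_sum fun k _ => ?_
  rw [← mul_sub, ← map_sub, H.ratio_one, mul_one, add_sub_cancel_left, map_mul, map_natCast]
  exact (dvd_mul_right _ _).mul_left _

/-- `(∑ A (i + 1) j t ^ (p j)) / (∑ A i j t ^ j)` is rational if its inverse is. -/
theorem expand_mul_inv_mem (H : IsDworkFamily p h A) {n i : ℕ} {e : ℕ → ℕ → R}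
    (he : ∀ k < p, ∀ j, A i (k + p * j) = A (i + 1) j * (A i k + p * e k j))
    (hq : quot H.ne_zero A e i (fun _ => 1) ∈ ratSubring p h n) :
    PowerSeries.expand p H.ne_zero (PowerSeries.mk (A (i + 1))) * inv A i ∈ ratSubring p h n := by
  obtain ⟨Q, hQ⟩ := H.trunc_dvd i
  refine inv_mem_ratSubring hq ?_ Q ?_
  · have := H.mk_eq_quot_mul he (fun _ => 1)
    simp only [one_mul] at this
    rw [← H.mk_mul_inv i, this]
    ring
  · conv => enter [2, 2]; rw [hQ, Polynomial.coe_mul]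
    rw [← sub_mul]
    exact (H.dvd_quot_one_sub i e).mul_right _

/-- Multiplying the coefficients of `∑ A i j t ^ j` by a uniformly continuous function of `j`
amounts to multiplying the series by a `p`-adic limit of rational functions. -/
theorem ratio_mem (H : IsDworkFamily p h A) (n : ℕ) :
    ∀ i c, PadicUC p c → ratio A i c ∈ ratSubring p h n := by
  induction n with
  | zero => exact fun i c _ => ⟨0, 0, by simp⟩
  | succ n ih =>
    have hex : ∀ i k, ∃ e : ℕ → R, k < p → PadicUC p e ∧
        ∀ j, A i (k + p * j) = A (i + 1) j * (A i k + p * e j) := by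
      intro i k
      by_cases hk : k < p
      · obtain ⟨e, he⟩ := H.exists_quot i k hk
        exact ⟨e, fun _ => he⟩
      · exact ⟨0, fun h => absurd h hk⟩
    choose e he using hex
    -- The error terms are multiplied by p, so for them the induction hypothesis at level n is
    -- enough.
    have hquot : ∀ i c, PadicUC p c →
        (∀ k < p, ratio A (i + 1) (fun j => c (k + p * j)) ∈ ratSubring p h (n + 1)) →
        quot H.ne_zero A (e i) i c ∈ ratSubring p h (n + 1) := fun i c hc hrat =>
      H.quot_mem hrat fun k hk => ih _ _ ((hc.comp_add_mul k p).mul (he i k hk).1)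
    -- For weight 1 the leading ratios are 1, so no hypothesis on them remains.
    have hexp := fun i => H.expand_mul_inv_mem (fun k hk => (he i k hk).2)
      (hquot i _ (PadicUC.const 1) fun k _ => by rw [H.ratio_one]; exact one_mem _)
    have hratio : ∀ i c, PadicUC p c →
        (∀ k < p, ratio A (i + 1) (fun j => c (k + p * j)) ∈ ratSubring p h (n + 1)) →
        ratio A i c ∈ ratSubring p h (n + 1) := by
      intro i c hc hrat
      rw [ratio, H.mk_eq_quot_mul (fun k hk => (he i k hk).2), mul_assoc]
      exact mul_mem (hquot i c hc hrat) (hexp i)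
    -- If c has period p^(M+1), each j ↦ c (k + p j) has period p^M; at M = 0 the weight is
    -- constant.
    have hper : ∀ M i c, (∀ j k, j ≡ k [MOD p ^ M] → c j = c k) →
        ratio A i c ∈ ratSubring p h (n + 1) := by
      intro M
      induction M with
      | zero =>
        intro i c hc
        have : ratio A i c = PowerSeries.C (c 0) * ratio A i (fun _ => 1) := by
          rw [ratio, ratio, ← mul_assoc]
          congr 1
          ext j
          rw [PowerSeries.coeff_C_mul, PowerSeries.coeff_mk, PowerSeries.coeff_mk, one_mul,
            hc j 0 (by rw [pow_zero]; exact Nat.modEq_one)]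
        rw [this, H.ratio_one, mul_one]
        exact C_mem_ratSubring _
      | succ M ihM =>
        intro i c hc
        refine hratio i c (fun n => ⟨M + 1, fun j k hjk => ?_⟩) fun k _ => ihM _ _ fun j l hjl => ?_
        · rw [hc j k hjk, sub_self]
          exact dvd_zero _
        · refine hc _ _ (Nat.ModEq.add_left _ ?_)
          rw [pow_succ']
          exact hjl.mul_left' p
    intro i c hc
    obtain ⟨M, hM⟩ := hc (n + 1)
    refine mem_ratSubring_of_dvd_sub (hper M i (fun j => c (j % p ^ M)) fun j k hjk => ?_) ?_
    · have : j % p ^ M = k % p ^ M := hjk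
      rw [this]
    · rw [ratio, ratio, ← sub_mul]
      refine Dvd.dvd.mul_right ?_ _
      choose d hd using fun j => hM j (j % p ^ M) (Nat.mod_modEq j _).symm
      refine ⟨PowerSeries.mk fun j => d j * A i j, ?_⟩
      ext j
      rw [← map_natCast (PowerSeries.C (R := R)), ← map_pow, PowerSeries.coeff_C_mul, map_sub,
        PowerSeries.coeff_mk, PowerSeries.coeff_mk, PowerSeries.coeff_mk, ← sub_mul, hd, mul_assoc]

end IsDworkFamily

end

section

/-! ### Products of `p`-adic units over intervals -/

theorem dvd_prod_sub_prod {R ι : Type*} [CommRing R] {d : R} (s : Finset ι) {f g : ι → R}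
    (h : ∀ i ∈ s, d ∣ f i - g i) : d ∣ ∏ i ∈ s, f i - ∏ i ∈ s, g i := by
  simp only [← Ideal.mem_span_singleton, ← Ideal.Quotient.mk_eq_mk_iff_sub_mem] at h ⊢
  rw [map_prod, map_prod]
  exact Finset.prod_congr rfl h

variable {p : ℕ} [Fact p.Prime]

theorem isUnit_iff_not_dvd (x : ℤ_[p]) : IsUnit x ↔ ¬ (p : ℤ_[p]) ∣ x := by
  rw [← PadicInt.norm_lt_one_iff_dvd, PadicInt.isUnit_iff, not_lt]
  exact ⟨fun h => h.ge, fun h => le_antisymm (PadicInt.norm_le_one x) h⟩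

theorem toZModPow_eq_iff {M : ℕ} {x y : ℤ_[p]} :
    PadicInt.toZModPow M x = PadicInt.toZModPow M y ↔ (p : ℤ_[p]) ^ M ∣ x - y := by
  rw [← Ideal.mem_span_singleton, ← PadicInt.ker_toZModPow, RingHom.mem_ker, map_sub, sub_eq_zero]

theorem padicInt_natCast_dvd_natCast {n : ℕ} : (p : ℤ_[p]) ∣ (n : ℤ_[p]) ↔ p ∣ n := by
  have := PadicInt.pow_p_dvd_int_iff (p := p) 1 (n : ℤ)
  rw [pow_one, pow_one] at this
  rw [← Int.natCast_dvd_natCast, ← this, Int.cast_natCast]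

theorem p_ne_zero : (p : ℤ_[p]) ≠ 0 := Nat.cast_ne_zero.2 (Fact.out : p.Prime).ne_zero

open Classical in
/-- The `p`-adic integer `x` if it is a unit, and `1` otherwise. -/
def unitOrOne (x : ℤ_[p]) : ℤ_[p] := if (p : ℤ_[p]) ∣ x then 1 else x

theorem unitOrOne_of_dvd {x : ℤ_[p]} (h : (p : ℤ_[p]) ∣ x) : unitOrOne x = 1 := if_pos h

theorem unitOrOne_of_not_dvd {x : ℤ_[p]} (h : ¬ (p : ℤ_[p]) ∣ x) : unitOrOne x = x := if_neg h

theorem isUnit_unitOrOne (x : ℤ_[p]) : IsUnit (unitOrOne x) := by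
  by_cases h : (p : ℤ_[p]) ∣ x
  · rw [unitOrOne_of_dvd h]; exact isUnit_one
  · rw [unitOrOne_of_not_dvd h]; exact (isUnit_iff_not_dvd x).2 h

theorem dvd_unitOrOne_sub {M : ℕ} (hM : M ≠ 0) {x y : ℤ_[p]} (h : (p : ℤ_[p]) ^ M ∣ x - y) :
    (p : ℤ_[p]) ^ M ∣ unitOrOne x - unitOrOne y := by
  have hxy := dvd_iff_dvd_of_dvd_sub ((dvd_pow_self _ hM).trans h)
  by_cases hy : (p : ℤ_[p]) ∣ y
  · rw [unitOrOne_of_dvd hy, unitOrOne_of_dvd (hxy.2 hy), sub_self]; exact dvd_zero _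
  · rwa [unitOrOne_of_not_dvd hy, unitOrOne_of_not_dvd (mt hxy.1 hy)]

/-- `∏_{i < n, p ∤ b + i} (b + i)`. -/
def unitProd (b : ℤ_[p]) (n : ℕ) : ℤ_[p] := ∏ i ∈ Finset.range n, unitOrOne (b + i)

theorem isUnit_unitProd (b : ℤ_[p]) (n : ℕ) : IsUnit (unitProd b n) :=
  IsUnit.prod_iff.2 fun _ _ => isUnit_unitOrOne _

theorem unitProd_add (b : ℤ_[p]) (m n : ℕ) :
    unitProd b (m + n) = unitProd b m * unitProd (b + (m : ℤ_[p])) n := by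
  simp only [unitProd, Finset.prod_range_add, Nat.cast_add, add_assoc]

/-- The product over a full period does not depend on where it starts, modulo `p ^ M`. -/
theorem dvd_unitProd_period_sub {M : ℕ} (hM : M ≠ 0) (b : ℤ_[p]) :
    (p : ℤ_[p]) ^ M ∣ unitProd b (p ^ M) - unitProd 0 (p ^ M) := by
  have hnat : ∀ m : ℕ, (p : ℤ_[p]) ^ M ∣ unitProd (m : ℤ_[p]) (p ^ M) - unitProd 0 (p ^ M) := by
    intro m
    induction m with
    | zero => simp
    | succ m ih =>
      -- Shifting the window by one trades the factor at m for the one at m + p^M, congruent to it.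
      have h1 : unitProd (m : ℤ_[p]) (p ^ M) * unitOrOne ((m : ℤ_[p]) + (p : ℤ_[p]) ^ M) =
          unitOrOne (m : ℤ_[p]) * unitProd ((m + 1 : ℕ) : ℤ_[p]) (p ^ M) := by
        have h2 := unitProd_add (m : ℤ_[p]) (p ^ M) 1
        have h3 := unitProd_add (m : ℤ_[p]) 1 (p ^ M)
        rw [add_comm 1, h2] at h3
        simpa [unitProd] using h3
      have h4 := dvd_unitOrOne_sub hM (x := (m : ℤ_[p]) + (p : ℤ_[p]) ^ M) (y := m) (by simp)
      have h5 : (p : ℤ_[p]) ^ M ∣ unitOrOne (m : ℤ_[p]) *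
          (unitProd ((m + 1 : ℕ) : ℤ_[p]) (p ^ M) - unitProd 0 (p ^ M)) := by
        have := dvd_add (h4.mul_left (unitProd (m : ℤ_[p]) (p ^ M)))
          (ih.mul_left (unitOrOne (m : ℤ_[p])))
        convert this using 1
        linear_combination -h1
      exact (isUnit_unitOrOne _).dvd_mul_left.1 h5
  have : NeZero (p ^ M) := ⟨pow_ne_zero _ (Fact.out : p.Prime).ne_zero⟩
  -- Only b mod p^M matters, so b is replaced by a natural number.
  set m := (PadicInt.toZModPow M b).val with hm
  have hbm : (p : ℤ_[p]) ^ M ∣ b - m := by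
    rw [← toZModPow_eq_iff, map_natCast, hm, ZMod.natCast_zmod_val]
  have := dvd_prod_sub_prod (Finset.range (p ^ M)) (f := fun i => unitOrOne (b + i))
    (g := fun i => unitOrOne ((m : ℤ_[p]) + i)) (d := (p : ℤ_[p]) ^ M)
    fun i _ => dvd_unitOrOne_sub hM (by rwa [add_sub_add_right_eq_sub])
  simpa [unitProd] using dvd_add this (hnat m)

/-- `∏_{i < n, p ∤ b + i} (b + i) / ∏_{1 ≤ i ≤ n, p ∤ i} i`. -/
def unitRatio (b : ℤ_[p]) (n : ℕ) : ℤ_[p] := unitProd b n * Ring.inverse (unitProd 1 n)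

theorem unitRatio_mul (b : ℤ_[p]) (n : ℕ) : unitRatio b n * unitProd 1 n = unitProd b n := by
  rw [unitRatio, mul_assoc, Ring.inverse_mul_cancel _ (isUnit_unitProd 1 n), mul_one]

theorem isUnit_unitRatio (b : ℤ_[p]) (n : ℕ) : IsUnit (unitRatio b n) :=
  isUnit_of_mul_isUnit_left (unitRatio_mul b n ▸ isUnit_unitProd b n)

/-- Numerator and denominator are each multiplied by a product over a full period. These agree mod
p^M, and everything in sight is a unit. -/
theorem dvd_unitRatio_add_sub (b : ℤ_[p]) {M : ℕ} (hM : M ≠ 0) (k : ℕ) :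
    (p : ℤ_[p]) ^ M ∣ unitRatio b (k + p ^ M) - unitRatio b k := by
  have h1 := unitRatio_mul b k
  have h2 := unitRatio_mul b (k + p ^ M)
  rw [unitProd_add, unitProd_add] at h2
  have h3 := dvd_sub (dvd_unitProd_period_sub hM (b + (k : ℤ_[p]))) (dvd_unitProd_period_sub hM (1 + (k : ℤ_[p])))
  have h4 : (p : ℤ_[p]) ^ M ∣ (unitProd 1 k * unitProd (1 + (k : ℤ_[p])) (p ^ M)) *
      (unitRatio b (k + p ^ M) - unitRatio b k) := by
    convert h3.mul_left (unitProd b k) using 1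
    linear_combination h2 - unitProd (1 + (k : ℤ_[p])) (p ^ M) * h1
  exact ((isUnit_unitProd _ _).mul (isUnit_unitProd _ _)).dvd_mul_left.1 h4

theorem padicUC_unitRatio (b : ℤ_[p]) : PadicUC p (unitRatio b) :=
  PadicUC.of_step fun n => ⟨n + 1, fun k =>
    (pow_dvd_pow _ n.le_succ).trans (dvd_unitRatio_add_sub b n.succ_ne_zero k)⟩

theorem p_dvd_unitRatio_sub (b : ℤ_[p]) (k j : ℕ) :
    (p : ℤ_[p]) ∣ unitRatio b (k + p * j) - unitRatio b k := by
  induction j with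
  | zero => simp
  | succ j ih =>
    have := dvd_unitRatio_add_sub b one_ne_zero (k + p * j)
    rw [pow_one, pow_one] at this
    rw [mul_add, mul_one, ← add_assoc]
    simpa using dvd_add this ih

/-! ### Pochhammer symbols at `k + p j` -/

theorem factorial_mul_multichoose (b : ℤ_[p]) (n : ℕ) :
    (n.factorial : ℤ_[p]) * Ring.multichoose b n = ∏ i ∈ Finset.range n, (b + i) := by
  rw [← nsmul_eq_mul, Ring.factorial_nsmul_multichoose_eq_ascPochhammer,
    ascPochhammer_smeval_eq_eval]
  induction n with
  | zero => simp
  | succ n ih => rw [ascPochhammer_succ_eval, Finset.prod_range_succ, ih]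

section Dwork

variable {b b' : ℤ_[p]} {l : ℕ}

theorem dvd_add_iff (hl : l < p) (hb : (p : ℤ_[p]) * b' = b + l) {k : ℕ} (hk : k < p) (j : ℕ) :
    (p : ℤ_[p]) ∣ b + (k + p * j : ℕ) ↔ k = l := by
  have h1 : (p : ℤ_[p]) ∣ b + (k + p * j : ℕ) ↔ (p : ℤ_[p]) ∣ (k : ℤ_[p]) - l := by
    refine dvd_iff_dvd_of_dvd_sub ⟨b' + j, ?_⟩
    push_cast
    linear_combination -hb
  rw [h1]
  constructor
  · intro h
    rw [← pow_one (p : ℤ_[p]), ← toZModPow_eq_iff, map_natCast, map_natCast,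
      ZMod.natCast_eq_natCast_iff, pow_one] at h
    exact Nat.ModEq.eq_of_lt_of_lt h hk hl
  · rintro rfl
    simp

-- Each block of p consecutive factors b + i contains exactly one divisible by p, at i = l + p j,
-- where it equals p (b' + j). An incomplete last block contributes it only if l < k.
open Classical in
theorem prod_non_unit (hl : l < p) (hb : (p : ℤ_[p]) * b' = b + l) {k : ℕ} (hk : k ≤ p) (j : ℕ) :
    ∏ i ∈ Finset.range (k + p * j), (if (p : ℤ_[p]) ∣ b + (i : ℤ_[p]) then b + (i : ℤ_[p]) else 1) =
      (∏ i ∈ Finset.range j, ((p : ℤ_[p]) * (b' + i))) *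
        if l < k then (p : ℤ_[p]) * (b' + j) else 1 := by
  have hpart : ∀ j : ℕ, ∀ k ≤ p, ∏ i ∈ Finset.range k,
      (if (p : ℤ_[p]) ∣ b + ((p * j + i : ℕ) : ℤ_[p]) then b + ((p * j + i : ℕ) : ℤ_[p]) else 1) =
        if l < k then (p : ℤ_[p]) * (b' + j) else 1 := by
    intro j k hk
    trans ∏ i ∈ Finset.range k, if i = l then (p : ℤ_[p]) * (b' + j) else 1
    · refine Finset.prod_congr rfl fun i hi => ?_
      rw [Finset.mem_range] at hi
      simp only [add_comm (p * j) i]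
      by_cases hil : i = l
      · rw [if_pos hil, if_pos ((dvd_add_iff hl hb (hi.trans_le hk) j).2 hil), hil]
        push_cast
        linear_combination -hb
      · rw [if_neg hil, if_neg (mt (dvd_add_iff hl hb (hi.trans_le hk) j).1 hil)]
    · rw [Finset.prod_ite_eq']
      simp
  have hfull : ∀ j : ℕ, ∏ i ∈ Finset.range (p * j),
      (if (p : ℤ_[p]) ∣ b + (i : ℤ_[p]) then b + (i : ℤ_[p]) else 1) =
      ∏ i ∈ Finset.range j, ((p : ℤ_[p]) * (b' + i)) := by
    intro j
    induction j with
    | zero => simp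
    | succ j ih =>
      rw [mul_add, mul_one, Finset.prod_range_add, ih, Finset.prod_range_succ, hpart j p le_rfl,
        if_pos hl]
  rw [add_comm k, Finset.prod_range_add, hfull, hpart j k hk]

theorem prod_add_eq (hl : l < p) (hb : (p : ℤ_[p]) * b' = b + l) {k : ℕ} (hk : k ≤ p) (j : ℕ) :
    ∏ i ∈ Finset.range (k + p * j), (b + i) =
      unitProd b (k + p * j) * ((∏ i ∈ Finset.range j, ((p : ℤ_[p]) * (b' + i))) *
        if l < k then (p : ℤ_[p]) * (b' + j) else 1) := by
  classical
  rw [← prod_non_unit hl hb hk, unitProd, ← Finset.prod_mul_distrib]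
  refine Finset.prod_congr rfl fun i _ => ?_
  by_cases h : (p : ℤ_[p]) ∣ b + i
  · rw [if_pos h, unitOrOne_of_dvd h, one_mul]
  · rw [if_neg h, unitOrOne_of_not_dvd h, mul_one]

/-- The quotient of `(b)_n / n!` at `n = k + p j` and `(b')_j / j!`. -/
def pochQuot (b b' : ℤ_[p]) (l k j : ℕ) : ℤ_[p] :=
  (if l < k then (p : ℤ_[p]) * (b' + j) else 1) * unitRatio b (k + p * j)

theorem multichoose_add_mul (hl : l < p) (hb : (p : ℤ_[p]) * b' = b + l) {k : ℕ} (hk : k < p)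
    (j : ℕ) : Ring.multichoose b (k + p * j) = Ring.multichoose b' j * pochQuot b b' l k j := by
  have hp : 0 < p := (Fact.out : p.Prime).pos
  have h1 := prod_add_eq hl hb hk.le j
  -- The factorial is the case b = b' = 1, l = p - 1; since k ≤ p - 1 its incomplete block has no
  -- factor divisible by p.
  have h2 := prod_add_eq (p := p) (b := 1) (b' := 1) (l := p - 1) (Nat.sub_lt hp one_pos)
    (by rw [Nat.cast_pred hp]; ring) hk.le j
  rw [if_neg (by omega), mul_one] at h2
  rw [← factorial_mul_multichoose, Finset.prod_mul_distrib, Finset.prod_const, Finset.card_range,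
    ← factorial_mul_multichoose] at h1
  rw [← factorial_mul_multichoose, Finset.prod_mul_distrib, Finset.prod_const, Finset.card_range,
    ← factorial_mul_multichoose, Ring.multichoose_one, Ring.multichoose_one, mul_one, mul_one] at h2
  have h3 := unitRatio_mul b (k + p * j)
  have h0 : (((k + p * j).factorial : ℕ) : ℤ_[p]) ≠ 0 :=
    Nat.cast_ne_zero.2 (Nat.factorial_ne_zero _)
  refine mul_left_cancel₀ h0 ?_
  rw [h1, h2, pochQuot, ← h3]
  ring

theorem padicUC_pochQuot (b b' : ℤ_[p]) (l k : ℕ) : PadicUC p (pochQuot b b' l k) := by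
  refine PadicUC.mul ?_ ((padicUC_unitRatio b).comp_add_mul k p)
  split_ifs
  · exact (PadicUC.const _).mul ((PadicUC.const _).add PadicUC.natCast)
  · exact PadicUC.const _

/-- For k > l both terms are divisible by p; for k ≤ l, `unitRatio` mod p depends only on the index
mod p. -/
theorem p_dvd_pochQuot_sub (b b' : ℤ_[p]) (l k j : ℕ) :
    (p : ℤ_[p]) ∣ pochQuot b b' l k j - pochQuot b b' l k 0 := by
  rw [pochQuot, pochQuot]
  split_ifs
  · exact dvd_sub ((dvd_mul_right _ _).mul_right _) ((dvd_mul_right _ _).mul_right _)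
  · rw [one_mul, one_mul]
    exact p_dvd_unitRatio_sub b k j

/-- Dwork's congruence `A (k + p j) ≡ A' j A k` modulo `p` for `A n = ((b)_n / n!) ^ s`, with
control of the error. -/
theorem exists_multichoose_pow_quot (s : ℕ) (hl : l < p) (hb : (p : ℤ_[p]) * b' = b + l) {k : ℕ}
    (hk : k < p) : ∃ e : ℕ → ℤ_[p], PadicUC p e ∧ ∀ j,
      Ring.multichoose b (k + p * j) ^ s =
        Ring.multichoose b' j ^ s * (Ring.multichoose b k ^ s + p * e j) := by
  have h0 : Ring.multichoose b k = pochQuot b b' l k 0 := by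
    simpa using multichoose_add_mul hl hb hk 0
  choose e he using fun j => (p_dvd_pochQuot_sub b b' l k j).trans
    (sub_dvd_pow_sub_pow _ _ s)
  refine ⟨e, PadicUC.of_p_mul p_ne_zero ?_, fun j => ?_⟩
  · simp only [← he]
    exact ((padicUC_pochQuot b b' l k).pow s).sub (PadicUC.const _)
  · rw [multichoose_add_mul hl hb hk, h0, ← he]
    ring

end Dwork

end

/-! ### The behaviour of `unitRatio b k` as `b + k → 0` -/

section

variable {p : ℕ} [Fact p.Prime]

/-- `1 / (i + 1)` if `p ∤ i + 1`, and `0` otherwise. -/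
def recip (p : ℕ) [Fact p.Prime] (i : ℕ) : ℤ_[p] :=
  if p ∣ i + 1 then 0 else Ring.inverse ((i + 1 : ℕ) : ℤ_[p])

theorem isUnit_natCast {n : ℕ} (h : ¬ p ∣ n) : IsUnit (n : ℤ_[p]) := by
  rwa [isUnit_iff_not_dvd, padicInt_natCast_dvd_natCast]

theorem recip_of_dvd {i : ℕ} (h : p ∣ i + 1) : recip p i = 0 := if_pos h

theorem mul_recip {i : ℕ} (h : ¬ p ∣ i + 1) : ((i : ℤ_[p]) + 1) * recip p i = 1 := by
  rw [recip, if_neg h]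
  have := Ring.mul_inverse_cancel _ (isUnit_natCast h)
  rwa [Nat.cast_succ] at this ⊢

theorem dvd_recip_add_sub (M i j : ℕ) :
    (p : ℤ_[p]) ^ (M + 1) ∣ recip p (i + p ^ (M + 1) * j) - recip p i := by
  have hiff : p ∣ i + p ^ (M + 1) * j + 1 ↔ p ∣ i + 1 := by
    rw [add_right_comm]
    exact (Nat.dvd_add_iff_left ((dvd_pow_self p M.succ_ne_zero).mul_right j)).symm
  by_cases h : p ∣ i + 1
  · rw [recip_of_dvd h, recip_of_dvd (hiff.2 h), sub_self]
    exact dvd_zero _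
  · have h1 := mul_recip h
    have h2 := mul_recip (mt hiff.1 h)
    push_cast at h2
    refine ⟨-(j * recip p i * recip p (i + p ^ (M + 1) * j)), ?_⟩
    linear_combination recip p i * h2 - recip p (i + p ^ (M + 1) * j) * h1

/-- `∏_{m < i ≤ m + n, p ∤ i} (1 - x / i)`. -/
def oneSubProd (m n : ℕ) (x : ℤ_[p]) : ℤ_[p] := ∏ i ∈ Finset.range n, (1 - x * recip p (m + i))

theorem oneSubProd_add (m n k : ℕ) (x : ℤ_[p]) :
    oneSubProd m (n + k) x = oneSubProd m n x * oneSubProd (m + n) k x := by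
  simp only [oneSubProd, Finset.prod_range_add, add_assoc]

theorem dvd_oneSubProd_sub_one (m n : ℕ) (x : ℤ_[p]) : x ∣ oneSubProd m n x - 1 := by
  have := dvd_prod_sub_prod (d := x) (Finset.range n) (f := fun i => 1 - x * recip p (m + i))
    (g := fun _ => 1) fun i _ => ⟨-recip p (m + i), by ring⟩
  simpa [oneSubProd] using this

/-- A period of length p^(M+2) consists of p blocks, all congruent to the first, T, mod x p^(M+1),
because the reciprocals are periodic mod p^(M+1). In T^p - 1 = (T - 1)(1 + ⋯ + T^(p-1)) the second
factor is divisible by p, since T ≡ 1 mod p. -/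
theorem dvd_oneSubProd_period_sub_one {x : ℤ_[p]} (hx : (p : ℤ_[p]) ∣ x) (M m : ℕ) :
    x * (p : ℤ_[p]) ^ M ∣ oneSubProd m (p ^ (M + 1)) x - 1 := by
  induction M generalizing m with
  | zero => simpa using dvd_oneSubProd_sub_one m _ x
  | succ M ih =>
    set T := oneSubProd m (p ^ (M + 1)) x with hT
    have hshift : ∀ j : ℕ, x * (p : ℤ_[p]) ^ (M + 1) ∣
        oneSubProd (m + p ^ (M + 1) * j) (p ^ (M + 1)) x - T := by
      refine fun j => dvd_prod_sub_prod _ fun i _ => ?_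
      rw [sub_sub_sub_cancel_left, ← mul_sub, add_right_comm]
      refine mul_dvd_mul_left x ?_
      rw [dvd_sub_comm]
      exact dvd_recip_add_sub M (m + i) j
    have hblock : ∀ n : ℕ, x * (p : ℤ_[p]) ^ (M + 1) ∣
        oneSubProd m (p ^ (M + 1) * n) x - T ^ n := by
      intro n
      induction n with
      | zero => simp [oneSubProd]
      | succ n ihn =>
        rw [mul_add, mul_one, oneSubProd_add]
        have := dvd_add (ihn.mul_right (oneSubProd (m + p ^ (M + 1) * n) (p ^ (M + 1)) x))
          ((hshift n).mul_left (T ^ n))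
        convert this using 1
        rw [pow_succ]
        ring
    have hpow : x * (p : ℤ_[p]) ^ (M + 1) ∣ T ^ p - 1 := by
      rw [← mul_geom_sum, pow_succ, ← mul_assoc]
      refine mul_dvd_mul (ih m) ?_
      have hT1 : (p : ℤ_[p]) ∣ T - 1 := (hx.mul_right _).trans (ih m)
      have hsum : (p : ℤ_[p]) ∣ ∑ i ∈ Finset.range p, (T ^ i - 1) :=
        Finset.dvd_sum fun i _ => hT1.trans (sub_one_dvd_pow_sub_one T i)
      rw [Finset.sum_sub_distrib] at hsum
      simpa using dvd_add hsum (dvd_refl (p : ℤ_[p]))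
    have := dvd_add (hblock p) hpow
    rwa [sub_add_sub_cancel, ← pow_succ] at this

/-- Having D as a polynomial allows its values at two congruent points to be compared. -/
theorem exists_oneSubProd_eq (n : ℕ) :
    ∃ D : ℤ_[p][X], ∀ x, oneSubProd 0 n x = 1 + x * D.eval x := by
  induction n with
  | zero => exact ⟨0, by simp [oneSubProd]⟩
  | succ n ih =>
    obtain ⟨D, hD⟩ := ih
    refine ⟨D * (1 - X * C (recip p n)) - C (recip p n), fun x => ?_⟩
    rw [oneSubProd_add, hD, oneSubProd]
    simp
    ring

/-- The difference quotient at `0` of `x ↦ ∏_{i ≤ k, p ∤ i} (1 - x / i)` for `k = l + p j`,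
at `x = p (b' + j)`. -/
theorem exists_padicUC_oneSubProd {b' : ℤ_[p]} (l : ℕ)
    (hne : ∀ j : ℕ, b' + j ≠ 0) : ∃ D : ℕ → ℤ_[p], PadicUC p D ∧ ∀ j,
      oneSubProd 0 (l + p * j) ((p : ℤ_[p]) * (b' + (j : ℤ_[p]))) =
        1 + (p : ℤ_[p]) * (b' + j) * D j := by
  choose D hD using exists_oneSubProd_eq (p := p)
  refine ⟨fun j => (D (l + p * j)).eval (p * (b' + j)), PadicUC.of_step fun n => ⟨n, fun j => ?_⟩,
    fun j => hD _ _⟩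
  set y : ℤ_[p] := p * (b' + (j + p ^ n : ℕ)) with hy
  have hy0 : y ≠ 0 := mul_ne_zero p_ne_zero (hne _)
  obtain ⟨z, hz⟩ := dvd_oneSubProd_period_sub_one (x := y) (dvd_mul_right _ _) n (l + p * j)
  have hk : l + p * (j + p ^ n) = l + p * j + p ^ (n + 1) := by ring
  have h1 := oneSubProd_add 0 (l + p * j) (p ^ (n + 1)) y
  rw [← hk, hD, hD, zero_add] at h1
  -- The extra period contributes 1 + y p^n z. Cancelling y ≠ 0 shows that the two polynomials agree
  -- at y mod p^n; moving from y to p (b' + j) also costs only a multiple of p^n.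
  have h2 : (D (l + p * (j + p ^ n))).eval y =
      (D (l + p * j)).eval y + (1 + y * (D (l + p * j)).eval y) * (p ^ n * z) := by
    refine mul_left_cancel₀ hy0 ?_
    linear_combination h1 + (1 + y * (D (l + p * j)).eval y) * hz
  have h3 := Polynomial.sub_dvd_eval_sub y (p * (b' + j)) (D (l + p * j))
  have h4 : (p : ℤ_[p]) ^ n ∣ y - p * (b' + j) := ⟨p, by rw [hy]; push_cast; ring⟩
  rw [h2, add_sub_right_comm]
  exact dvd_add (h4.trans h3) ((dvd_mul_right _ _).mul_left _)

/-- Read backwards, the factors are (b + k) - i = -i (1 - (b + k)/i), and divisibility of b + k by p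
matches the omitted indices. The sign counts the i ≤ k prime to p, that is k - ⌊k/p⌋ of them. -/
theorem unitProd_eq_oneSubProd (b : ℤ_[p]) {k : ℕ} (hk : (p : ℤ_[p]) ∣ b + k) :
    unitProd b k = (-1) ^ (k + k / p) * unitProd 1 k * oneSubProd 0 k (b + (k : ℤ_[p])) := by
  have hsign : ∀ k : ℕ, (-1 : ℤ_[p]) ^ (k + k / p) =
      ∏ i ∈ Finset.range k, if p ∣ i + 1 then 1 else -1 := by
    intro k
    induction k with
    | zero => simp
    | succ k ih =>
      rw [Finset.prod_range_succ, ← ih, Nat.succ_div]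
      split_ifs <;> ring
  rw [hsign, unitProd, unitProd, oneSubProd, ← Finset.prod_mul_distrib, ← Finset.prod_mul_distrib,
    ← Finset.prod_range_reflect]
  refine Finset.prod_congr rfl fun i hi => ?_
  rw [Finset.mem_range] at hi
  have hcast : b + ((k - 1 - i : ℕ) : ℤ_[p]) = (b + k) - ((i + 1 : ℕ) : ℤ_[p]) := by
    rw [Nat.sub_sub, Nat.cast_sub (by omega)]
    push_cast
    ring
  have hiff : (p : ℤ_[p]) ∣ b + ((k - 1 - i : ℕ) : ℤ_[p]) ↔ p ∣ i + 1 := by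
    rw [hcast, dvd_sub_right hk, padicInt_natCast_dvd_natCast]
  have hiff' : (p : ℤ_[p]) ∣ 1 + (i : ℤ_[p]) ↔ p ∣ i + 1 := by
    rw [← padicInt_natCast_dvd_natCast (p := p), Nat.cast_succ, add_comm]
  by_cases h : p ∣ i + 1
  · rw [unitOrOne_of_dvd (hiff.2 h), unitOrOne_of_dvd (hiff'.2 h), if_pos h, zero_add,
      recip_of_dvd h]
    ring
  · rw [unitOrOne_of_not_dvd (mt hiff.1 h), unitOrOne_of_not_dvd (mt hiff'.1 h), if_neg h, zero_add,
      hcast]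
    push_cast
    linear_combination (-(b + k)) * mul_recip h

theorem unitRatio_eq_oneSubProd (b : ℤ_[p]) {k : ℕ} (hk : (p : ℤ_[p]) ∣ b + k) :
    unitRatio b k = (-1) ^ (k + k / p) * oneSubProd 0 k (b + (k : ℤ_[p])) := by
  refine (isUnit_unitProd 1 k).mul_right_cancel ?_
  rw [unitRatio_mul, unitProd_eq_oneSubProd b hk]
  ring

/-! ### The sign -/

theorem padicUC_inverse {c : ℕ → ℤ_[p]} (hc : PadicUC p c) (hu : ∀ j, IsUnit (c j)) :
    PadicUC p fun j => Ring.inverse (c j) :=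
  hc.of_mul_eq_one fun j => Ring.mul_inverse_cancel _ (hu j)

theorem negRes_lt (m : ℕ) (a : ℤ_[p]) : negRes m a < p ^ m := by
  have : NeZero (p ^ m) := ⟨pow_ne_zero _ (Fact.out : p.Prime).ne_zero⟩
  exact ZMod.val_lt _

theorem negRes_one_lt (a : ℤ_[p]) : negRes 1 a < p := by
  simpa using negRes_lt 1 a

/-- The sign of `unitRatio a k`, `k = l + p j`, agrees with `(-1) ^ e` up to a multiple of
`a + k`. -/
theorem exists_padicUC_sign (s : ℕ) (a : ℤ_[p]) : ∃ η : ℕ → ℤ_[p], PadicUC p η ∧ ∀ j,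
    (1 : ℤ_[p]) - ((-1) ^ (negRes 1 a + p * j + (negRes 1 a + p * j) / p)) ^ s *
      (-1) ^ (s * signExp a) = p * (dworkPrime a + j) * η j := by
  have hp : p.Prime := Fact.out
  have hl := negRes_one_lt a
  have hdiv : ∀ j, (negRes 1 a + p * j) / p = j := fun j => by
    rw [Nat.add_mul_div_left _ _ hp.pos, Nat.div_eq_of_lt hl, zero_add]
  simp only [hdiv]
  by_cases hp2 : p = 2
  · subst hp2
    have hl' := negRes_lt 2 a
    have h2 := pow_dvd_add_negRes 2 a
    have h1 := p_mul_dworkPrime a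
    have hmod : negRes 2 a % 2 = negRes 1 a := by
      have h3 : ((2 : ℕ) : ℤ_[2]) ^ 1 ∣ (negRes 2 a : ℤ_[2]) - negRes 1 a := by
        have := dvd_sub ((pow_dvd_pow _ one_le_two).trans h2) (pow_dvd_add_negRes 1 a)
        simpa using this
      rw [← toZModPow_eq_iff, map_natCast, map_natCast, ZMod.natCast_eq_natCast_iff] at h3
      have h4 : negRes 2 a % 2 = negRes 1 a % 2 := h3
      rw [h4, Nat.mod_eq_of_lt hl]
    -- With l' = l + 2 j0, the total sign exponent has the parity of s (j + j0).
    have he : signExp a = negRes 1 a + negRes 2 a / 2 := by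
      rw [signExp, if_pos rfl]
      omega
    have hdvd : ((2 : ℕ) : ℤ_[2]) ∣ dworkPrime a + ((negRes 2 a / 2 : ℕ) : ℤ_[2]) := by
      obtain ⟨z, hz⟩ := h2
      refine ⟨z, mul_left_cancel₀ (p_ne_zero (p := 2)) ?_⟩
      have h5 : (negRes 2 a : ℤ_[2]) = negRes 1 a + 2 * (negRes 2 a / 2 : ℕ) := by
        rw [← hmod]
        exact_mod_cast (Nat.mod_add_div _ _).symm
      rw [h5] at hz
      push_cast at hz h1 ⊢
      linear_combination hz + h1
    set j0 := negRes 2 a / 2 with hj0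
    obtain ⟨m, hm⟩ : ∃ m : ℤ_[2], 1 - (-1) ^ s = 2 * m := by
      rcases Nat.even_or_odd s with h | h
      · exact ⟨0, by rw [h.neg_one_pow]; ring⟩
      · exact ⟨1, by rw [h.neg_one_pow]; ring⟩
    have hunit : ∀ j : ℕ, j % 2 ≠ j0 % 2 → IsUnit (dworkPrime a + (j : ℤ_[2])) := by
      intro j hj
      rw [isUnit_iff_not_dvd]
      intro h
      have h6 := dvd_sub h hdvd
      rw [add_sub_add_left_eq_sub, ← pow_one ((2 : ℕ) : ℤ_[2]), ← toZModPow_eq_iff, map_natCast,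
        map_natCast, ZMod.natCast_eq_natCast_iff] at h6
      exact hj h6
    -- If j and j0 differ in parity, a' + j is a unit because 2 ∣ a' + j0, so 1 - (-1)^s = 2 m is a
    -- multiple of 2 (a' + j).
    refine ⟨fun j => if j % 2 = j0 % 2 then 0 else m * Ring.inverse (dworkPrime a + j),
      PadicUC.of_residues two_pos fun k hk => ?_, fun j => ?_⟩
    · have hk2 : ∀ j, (k + 2 * j) % 2 = k := fun j => by omega
      simp only [hk2]
      split_ifs with hkj
      · exact PadicUC.const 0
      · refine (PadicUC.const m).mul (padicUC_inverse (c := fun j => dworkPrime a +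
          ((k + 2 * j : ℕ) : ℤ_[2])) ?_ fun j => hunit _ (by rwa [hk2]))
        exact (PadicUC.const _).add (PadicUC.natCast.comp_add_mul k 2)
    · rw [he, ← pow_mul, mul_comm _ s, ← pow_add, ← mul_add]
      beta_reduce
      split_ifs with hj
      · rw [Even.neg_one_pow]
        · ring
        · refine Even.mul_left ?_ s
          rw [Nat.even_iff]
          omega
      · rw [pow_mul', Odd.neg_one_pow]
        · have := Ring.mul_inverse_cancel _ (hunit j hj)
          push_cast
          linear_combination hm - 2 * m * this
        · rw [Nat.odd_iff]
          omega
  -- For odd p, l + p j + j has the parity of l = e, so the signs agree exactly.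
  · refine ⟨0, PadicUC.const 0, fun j => ?_⟩
    have he : signExp a = negRes 1 a := by
      rw [signExp, if_neg hp2, Nat.div_eq_of_lt hl, Nat.sub_zero]
    have hodd : p % 2 = 1 := (hp.eq_two_or_odd).resolve_left hp2
    rw [he, ← pow_mul, mul_comm _ s, ← pow_add, ← mul_add, Even.neg_one_pow]
    · simp
    · refine Even.mul_left ?_ s
      obtain ⟨t, ht⟩ := Nat.odd_iff.2 hodd
      exact ⟨negRes 1 a + t * j + j, by linarith [congrArg (· * j) ht]⟩

end

section

variable {p : ℕ} [Fact p.Prime]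

/-! ### The powers of `1 + p u` -/

theorem PadicUC.of_approx {R : Type*} [CommRing R] {p : ℕ} {c : ℕ → R}
    (h : ∀ n, ∃ d : ℕ → R, PadicUC p d ∧ ∀ j, (p : R) ^ n ∣ c j - d j) : PadicUC p c := fun n => by
  obtain ⟨d, hd, hcd⟩ := h n
  obtain ⟨M, hM⟩ := hd n
  refine ⟨M, fun i j hij => ?_⟩
  have := dvd_sub (dvd_add (hcd i) (hM i j hij)) (hcd j)
  convert this using 1
  ring

/-- Compactness of ℤ_p makes f uniformly continuous. -/
theorem padicUC_of_continuous {f : ℤ_[p] → ℤ_[p]} (hf : Continuous f) (b : ℤ_[p]) :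
    PadicUC p fun j => f (b + j) := fun n => by
  have hp : (1 : ℝ) < p := mod_cast (Fact.out : p.Prime).one_lt
  have hu := CompactSpace.uniformContinuous_of_continuous hf
  rw [Metric.uniformContinuous_iff] at hu
  obtain ⟨δ, hδ, h⟩ := hu ((p : ℝ) ^ (-n : ℤ)) (by positivity)
  obtain ⟨M, hM⟩ := PadicInt.exists_pow_neg_lt p hδ
  refine ⟨M, fun i j hij => ?_⟩
  rw [← Ideal.mem_span_singleton, ← PadicInt.norm_le_pow_iff_mem_span_pow]
  rw [← dist_eq_norm]
  refine (h ?_).le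
  refine lt_of_le_of_lt ?_ hM
  rw [dist_eq_norm, PadicInt.norm_le_pow_iff_mem_span_pow, Ideal.mem_span_singleton,
    add_sub_add_left_eq_sub]
  rw [← toZModPow_eq_iff, map_natCast, map_natCast, ZMod.natCast_eq_natCast_iff]
  exact hij

theorem zpToW_injective : Function.Injective (zpToW : ℤ_[p] →+* W p) := by
  rw [zpToW, RingHom.coe_comp]
  exact (WittVector.map_injective _ (algebraMap (ZMod p) (AlgebraicClosure (ZMod p))).injective).comp
    (WittVector.equiv p).symm.injective

theorem zpToW_ne_zero {x : ℤ_[p]} (hx : x ≠ 0) : zpToW x ≠ 0 :=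
  (map_ne_zero_iff _ zpToW_injective).2 hx

theorem frobenius_zpToW (x : ℤ_[p]) : WittVector.frobenius (zpToW x) = zpToW x := by
  rw [zpToW, RingHom.comp_apply]
  conv_rhs => rw [← WittVector.frobenius_zmodp p ((WittVector.equiv p).symm.toRingHom x)]
  ext n
  rw [WittVector.coeff_frobenius_charP, WittVector.map_coeff, WittVector.map_coeff,
    WittVector.coeff_frobenius_charP, map_pow]

/-- The numbers `p ^ (i - 1) / i` are `p`-adic integers tending to `0`. -/
theorem exists_dividedPow (i : ℕ) : ∃ d : ℤ_[p], ((i : ℤ_[p]) + 1) * d = (p : ℤ_[p]) ^ i ∧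
    ∀ n, 2 * n + 1 ≤ i → (p : ℤ_[p]) ^ n ∣ d := by
  have hp : p.Prime := Fact.out
  obtain ⟨v, m, hm, hi⟩ := Nat.exists_eq_pow_mul_and_not_dvd i.succ_ne_zero p hp.ne_one
  have hm0 : 0 < m := Nat.pos_of_ne_zero fun h => hm (h ▸ dvd_zero p)
  have hv : 2 ^ v ≤ i + 1 := by
    rw [← Nat.succ_eq_add_one, hi]
    exact (Nat.pow_le_pow_left hp.two_le v).trans (Nat.le_mul_of_pos_right _ hm0)
  have hvi : v ≤ i := by
    have := Nat.lt_two_pow_self (n := v)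
    omega
  have hcast : (i : ℤ_[p]) + 1 = (p : ℤ_[p]) ^ v * m := by
    exact_mod_cast congrArg (Nat.cast (R := ℤ_[p])) hi
  refine ⟨(p : ℤ_[p]) ^ (i - v) * Ring.inverse (m : ℤ_[p]), ?_, fun n hn => ?_⟩
  · rw [hcast]
    have h1 := Ring.mul_inverse_cancel _ (isUnit_natCast hm)
    have h2 : (p : ℤ_[p]) ^ i = (p : ℤ_[p]) ^ v * (p : ℤ_[p]) ^ (i - v) := by
      rw [← pow_add, Nat.add_sub_cancel' hvi]
    rw [h2]
    linear_combination (p : ℤ_[p]) ^ v * (p : ℤ_[p]) ^ (i - v) * h1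
  · refine (pow_dvd_pow _ ?_).mul_right _
    by_contra hlt
    -- From w < 2^w and 2^(w+1) ≤ i + 1 follows 2 v ≤ i + 1, hence i - v ≥ n.
    obtain ⟨w, rfl⟩ : ∃ w, v = w + 1 := ⟨v - 1, by omega⟩
    have := Nat.lt_two_pow_self (n := w)
    rw [pow_succ] at hv
    omega

/-- By (i + 1) binom(α, i + 1) = α binom(α - 1, i), every nonconstant term of the binomial series
has a factor p α. -/
theorem choose_mul_pow {d : ℤ_[p]} {i : ℕ} (hd : ((i : ℤ_[p]) + 1) * d = (p : ℤ_[p]) ^ i)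
    (α : ℤ_[p]) : Ring.choose α (i + 1) * (p : ℤ_[p]) ^ (i + 1) =
      p * α * (Ring.choose (α - 1) i * d) := by
  have := Ring.choose_smul_choose α (n := i + 1) (k := 1) (by omega)
  rw [Nat.choose_one_right, Ring.choose_one_right, Nat.add_sub_cancel, nsmul_eq_mul, Nat.cast_one,
    Nat.cast_succ] at this
  rw [pow_succ, ← hd]
  linear_combination d * p * this

theorem onePlusPow_spec (u : W p) (α : ℤ_[p]) (n : ℕ) :
    (p : W p) ^ n ∣ onePlusPow u α - binomPartial u α n := (exists_binomLimit u α).choose_spec n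

/-- The difference quotient `(c ^ α - 1) / (p α)`, `c = 1 + p u`, modulo `p ^ n`. -/
theorem dvd_onePlusPow_sub (u : W p) {d : ℕ → ℤ_[p]}
    (hd : ∀ i : ℕ, ((i : ℤ_[p]) + 1) * d i = (p : ℤ_[p]) ^ i)
    (hd' : ∀ i n, 2 * n + 1 ≤ i → (p : ℤ_[p]) ^ n ∣ d i) {α : ℤ_[p]} (hα : α ≠ 0) (n : ℕ) :
    zpToW ((p : ℤ_[p]) * α) * (p : W p) ^ n ∣ onePlusPow u α - 1 - zpToW ((p : ℤ_[p]) * α) *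
      ∑ i ∈ Finset.range (2 * n + 1), zpToW (Ring.choose (α - 1) i * d i) * u ^ (i + 1) := by
  obtain ⟨N, hN⟩ : ∃ N, 2 * n + 1 ≤ N ∧ zpToW ((p : ℤ_[p]) * α) * (p : W p) ^ n ∣ (p : W p) ^ (N + 1) := by
    -- The valuation of α pays for the later division by p α.
    refine ⟨2 * n + 1 + α.valuation, by omega, ?_⟩
    have h1 : (p : ℤ_[p]) * α * p ^ n ∣ p ^ (2 * n + 1 + α.valuation + 1) := by
      conv_lhs => rw [PadicInt.unitCoeff_spec hα]
      rw [mul_left_comm, mul_assoc, (Units.isUnit _).mul_left_dvd, ← pow_succ', ← pow_add]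
      exact pow_dvd_pow _ (by omega)
    simpa using map_dvd zpToW h1
  have hpart : binomPartial u α (N + 1) = 1 + zpToW ((p : ℤ_[p]) * α) *
      ∑ i ∈ Finset.range N, zpToW (Ring.choose (α - 1) i * d i) * u ^ (i + 1) := by
    rw [binomPartial, Finset.sum_range_succ', Ring.choose_zero_right, map_one, pow_zero, pow_zero,
      mul_one, mul_one, add_comm, Finset.mul_sum]
    congr 1
    refine Finset.sum_congr rfl fun i _ => ?_
    have := congrArg (zpToW (p := p)) (choose_mul_pow (hd i) α)
    simp only [map_mul, map_pow, map_natCast] at this ⊢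
    linear_combination u ^ (i + 1) * this
  have h2 := hN.2.trans (onePlusPow_spec u α (N + 1))
  rw [hpart, ← Finset.sum_range_add_sum_Ico _ hN.1] at h2
  have h3 : zpToW ((p : ℤ_[p]) * α) * (p : W p) ^ n ∣ zpToW ((p : ℤ_[p]) * α) *
      ∑ i ∈ Finset.Ico (2 * n + 1) N, zpToW (Ring.choose (α - 1) i * d i) * u ^ (i + 1) := by
    refine mul_dvd_mul_left _ (Finset.dvd_sum fun i hi => ?_)
    have := map_dvd zpToW ((hd' i n (Finset.mem_Ico.1 hi).1).mul_left (Ring.choose (α - 1) i))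
    rw [map_pow, map_natCast] at this
    exact this.mul_right _
  convert dvd_add h2 h3 using 1
  ring

/-- Modulo p^n the difference quotient is a finite sum of terms binom(α - 1, i) d_i u^(i+1), each
continuous in α. -/
theorem exists_padicUC_onePlusPow (u : W p) {b : ℤ_[p]} (hb : ∀ j : ℕ, b + j ≠ 0) :
    ∃ E : ℕ → W p, PadicUC p E ∧
      ∀ j : ℕ, onePlusPow u (b + (j : ℤ_[p])) = 1 + zpToW ((p : ℤ_[p]) * (b + (j : ℤ_[p]))) * E j := by
  choose d hd hd' using exists_dividedPow (p := p)
  have hE : ∀ j : ℕ, ∃ E, onePlusPow u (b + (j : ℤ_[p])) - 1 = zpToW ((p : ℤ_[p]) * (b + (j : ℤ_[p]))) * E := by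
    intro j
    have := dvd_onePlusPow_sub u hd hd' (hb j) 0
    rw [pow_zero, mul_one] at this
    exact (dvd_sub_left (dvd_mul_right _ _)).1 this
  choose E hE using hE
  refine ⟨E, PadicUC.of_approx fun n => ⟨_, PadicUC.sum (Finset.range (2 * n + 1))
    (c := fun i j => zpToW (Ring.choose (b + (j : ℤ_[p]) - 1) i * d i) * u ^ (i + 1))
    fun i _ => ?_, fun j => ?_⟩, fun j => by rw [← hE]; ring⟩
  · refine ((PadicUC.mul ?_ (PadicUC.const (d i))).map zpToW).mul (PadicUC.const _)
    exact padicUC_of_continuous (f := fun x => Ring.choose (x - 1) i)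
      ((PadicInt.continuous_choose i).comp (continuous_sub_right 1)) b
  · have := dvd_onePlusPow_sub u hd hd' (hb j) n
    rw [hE, ← mul_sub] at this
    exact (mul_dvd_mul_iff_left (zpToW_ne_zero (mul_ne_zero p_ne_zero (hb j)))).1 this

/-! ### The coefficients of `hatG` -/

/-- Here w^s = σ P with σ a sign, P = 1 + x D S, c^α = 1 + x E and ψ = 1/P. Factoring out σ leaves P
- σ ε (1 + x E), in which x divides every term by `hη`. -/
theorem quot_identity {R : Type*} [CommRing R] {x D S η E P ψ σ ε : R} (hP : P * ψ = 1)
    (hS : S * (x * D) = P - 1) (hη : 1 - σ * ε = x * η) (hσ : σ * σ = 1) :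
    x * (((D * S + η) - (1 - x * η) * E) * ψ * (σ * P)) = σ * P - ε * (1 + x * E) := by
  linear_combination (x * σ * ((D * S + η) - (1 - x * η) * E)) * hP + σ * hS -
    (σ * (1 + x * E)) * hη - ε * (1 + x * E) * hσ

/-- The `p`-adically singular part of the coefficients of `hatG`. -/
theorem exists_padicUC_quot (s : ℕ) (a : ℤ_[p]) (u : W p) (ha : ∀ j : ℕ, dworkPrime a + j ≠ 0) :
    ∃ q : ℕ → W p, PadicUC p q ∧ ∀ j : ℕ,
      zpToW ((p : ℤ_[p]) * (dworkPrime a + (j : ℤ_[p]))) * (q j * zpToW (unitRatio a (negRes 1 a + p * j)) ^ s) =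
        zpToW (unitRatio a (negRes 1 a + p * j)) ^ s -
          (-1) ^ (s * signExp a) * onePlusPow u (dworkPrime a + (j : ℤ_[p])) := by
  obtain ⟨D, hD, hDΦ⟩ := exists_padicUC_oneSubProd (negRes 1 a) ha
  obtain ⟨E, hE, hEc⟩ := exists_padicUC_onePlusPow u ha
  obtain ⟨η, hη, hηδ⟩ := exists_padicUC_sign s a
  have hcast : ∀ j : ℕ, a + ((negRes 1 a + p * j : ℕ) : ℤ_[p]) = p * (dworkPrime a + j) := by
    intro j
    push_cast
    linear_combination -p_mul_dworkPrime a
  have hw : ∀ j : ℕ, unitRatio a (negRes 1 a + p * j) =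
      (-1) ^ (negRes 1 a + p * j + (negRes 1 a + p * j) / p) *
        (1 + (p : ℤ_[p]) * (dworkPrime a + j) * D j) := by
    intro j
    rw [unitRatio_eq_oneSubProd a (hcast j ▸ dvd_mul_right _ _), hcast, hDΦ]
  have hX : PadicUC p fun j : ℕ => (p : ℤ_[p]) * (dworkPrime a + j) :=
    (PadicUC.const _).mul ((PadicUC.const _).add PadicUC.natCast)
  set Φ : ℕ → ℤ_[p] := fun j => 1 + (p : ℤ_[p]) * (dworkPrime a + j) * D j with hΦ
  have hΦuc : PadicUC p Φ := (PadicUC.const 1).add (hX.mul hD)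
  have hΦu : ∀ j, IsUnit (Φ j ^ s) := fun j =>
    (isUnit_of_mul_isUnit_right (hw j ▸ isUnit_unitRatio a _)).pow s
  have hσ : ∀ k : ℕ, ((-1 : ℤ_[p]) ^ k) ^ s * ((-1 : ℤ_[p]) ^ k) ^ s = 1 := fun k => by
    rw [← mul_pow, ← mul_pow]
    simp
  refine ⟨fun j => (zpToW (D j) * zpToW (∑ i ∈ Finset.range s, Φ j ^ i) + zpToW (η j) -
      (1 - zpToW ((p : ℤ_[p]) * (dworkPrime a + (j : ℤ_[p]))) * zpToW (η j)) * E j) * zpToW (Ring.inverse (Φ j ^ s)),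
    PadicUC.mul (PadicUC.sub ?_ (PadicUC.mul ?_ hE)) ?_, fun j => ?_⟩
  · exact ((hD.map zpToW).mul ((PadicUC.sum _ fun i _ => hΦuc.pow i).map zpToW)).add (hη.map zpToW)
  · exact (PadicUC.const 1).sub ((hX.map zpToW).mul (hη.map zpToW))
  · exact (padicUC_inverse (hΦuc.pow s) hΦu).map zpToW
  · have h5 : Φ j - 1 = p * (dworkPrime a + j) * D j := by rw [hΦ]; ring
    have hS := geom_sum_mul (Φ j) s
    rw [h5] at hS
    have hP := Ring.mul_inverse_cancel _ (hΦu j)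
    have hη1 := hηδ j
    have hσ1 := hσ (negRes 1 a + p * j + (negRes 1 a + p * j) / p)
    have key := quot_identity (R := W p) (E := E j) (P := zpToW (Φ j ^ s))
      (x := zpToW ((p : ℤ_[p]) * (dworkPrime a + (j : ℤ_[p])))) (D := zpToW (D j))
      (S := zpToW (∑ i ∈ Finset.range s, Φ j ^ i)) (η := zpToW (η j))
      (σ := zpToW (((-1) ^ (negRes 1 a + p * j + (negRes 1 a + p * j) / p)) ^ s))
      (ε := zpToW ((-1) ^ (s * signExp a))) (ψ := zpToW (Ring.inverse (Φ j ^ s)))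
      (by rw [← map_mul, hP, map_one])
      (by rw [← map_mul, ← map_mul, hS, map_sub, map_one])
      (by rw [← map_mul, ← map_mul, ← hη1, map_sub, map_one])
      (by rw [← map_mul, hσ1, map_one])
    have hwW : zpToW (unitRatio a (negRes 1 a + p * j)) ^ s =
        zpToW (((-1) ^ (negRes 1 a + p * j + (negRes 1 a + p * j) / p)) ^ s) * zpToW (Φ j ^ s) := by
      rw [← map_pow, hw, mul_pow, map_mul]
    have hε : zpToW ((-1 : ℤ_[p]) ^ (s * signExp a)) = (-1 : W p) ^ (s * signExp a) := by
      rw [map_pow, map_neg, map_one]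
    rw [hε] at key
    rw [hEc, hwW]
    exact key

theorem tPowMul_apply (a : ℤ_[p]) (G : PowerSeries (W p)) (k : ℕ) :
    tPowMul a G (a + k) = PowerSeries.coeff k G :=
  Function.Injective.extend_apply (fun _ _ h => Nat.cast_injective (add_left_cancel h)) _ _ _

theorem sigma_apply (u : W p) (f : FormalSum p (W p)) (α : ℤ_[p]) :
    sigma u f ((p : ℤ_[p]) * α) = WittVector.frobenius (f α) * onePlusPow u α :=
  Function.Injective.extend_apply (mul_right_injective₀ p_ne_zero) _ _ _

theorem sigma_apply_of_not_dvd (u : W p) (f : FormalSum p (W p)) {x : ℤ_[p]}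
    (hx : ¬ (p : ℤ_[p]) ∣ x) : sigma u f x = 0 :=
  Function.extend_apply' _ _ _ fun ⟨α, hα⟩ => hx ⟨α, hα.symm⟩

theorem coeff_hyp (s : ℕ) (a : ℤ_[p]) (k : ℕ) :
    PowerSeries.coeff k (hyp s a) = zpToW (Ring.multichoose a k) ^ s :=
  PowerSeries.coeff_mk _ _

theorem dworkPrime_ne (a : ℤ_[p]) (ha : ∀ n : ℕ, a ≠ -(n : ℤ_[p])) (n : ℕ) :
    dworkPrime a ≠ -(n : ℤ_[p]) := by
  intro h
  have := p_mul_dworkPrime a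
  rw [h] at this
  refine ha (negRes 1 a + p * n) ?_
  push_cast
  linear_combination -this

/-- The coefficients of `hatG` are those of `hyp`, multiplied by a uniformly continuous function
of the index. -/
theorem exists_padicUC_hatG (s : ℕ) (a : ℤ_[p]) (ha : ∀ n : ℕ, a ≠ -(n : ℤ_[p])) (u : W p) :
    ∃ q : ℕ → W p, PadicUC p q ∧ ∀ k, PowerSeries.coeff k (hatG s a u) =
      algebraMap (W p) (K p) (q k * PowerSeries.coeff k (hyp s a)) := by
  classical
  have hp : p.Prime := Fact.out
  have ha' : ∀ j : ℕ, dworkPrime a + j ≠ 0 := fun j h =>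
    dworkPrime_ne a ha j (eq_neg_of_add_eq_zero_left h)
  obtain ⟨q, hq, hqeq⟩ := exists_padicUC_quot s a u ha'
  have hl := negRes_one_lt a
  have hb := p_mul_dworkPrime a
  have hiff : ∀ {k : ℕ} (_ : k < p) (j : ℕ), (p : ℤ_[p]) ∣ a + (k + p * j : ℕ) ↔ k = negRes 1 a :=
    fun hk j => dvd_add_iff hl hb hk j
  have hdiv : ∀ {k : ℕ} (_ : k < p) (j : ℕ), (k + p * j) / p = j := fun hk j => by
    rw [Nat.add_mul_div_left _ _ hp.pos, Nat.div_eq_of_lt hk, zero_add]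
  -- The Frobenius term reaches only exponents divisible by p; elsewhere a + k is a unit and
  -- integration just divides by it.
  refine ⟨fun k => if (p : ℤ_[p]) ∣ a + (k : ℤ_[p]) then q (k / p) else
    zpToW (Ring.inverse (a + k)), PadicUC.of_residues hp.pos fun k hk => ?_, fun k => ?_⟩
  · simp only [hiff hk, hdiv hk]
    split_ifs with hkl
    · exact hq
    · refine (padicUC_inverse (c := fun j => a + ((k + p * j : ℕ) : ℤ_[p])) ?_ fun j => ?_).map zpToW
      · exact (PadicUC.const _).add (PadicUC.natCast.comp_add_mul k p)
      · rw [isUnit_iff_not_dvd, hiff hk]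
        exact hkl
  · have hak : algebraMap (W p) (K p) (zpToW (a + k)) ≠ 0 := by
      rw [Ne, map_eq_zero_iff _ (IsFractionRing.injective (W p) (K p))]
      exact zpToW_ne_zero fun h => ha k (eq_neg_of_add_eq_zero_left h)
    rw [hatG, PowerSeries.coeff_mk, intDtOverT, div_eq_iff hak, ← map_mul]
    refine congrArg (algebraMap (W p) (K p)) ?_
    rw [Pi.sub_apply, Pi.smul_apply, tPowMul_apply, smul_eq_mul]
    beta_reduce
    split_ifs with hk
    · obtain ⟨j, rfl⟩ : ∃ j, k = negRes 1 a + p * j := by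
        have h1 := hiff (Nat.mod_lt k hp.pos) (k / p)
        rw [Nat.mod_add_div] at h1
        exact ⟨k / p, by rw [← h1.1 hk, Nat.mod_add_div]⟩
      have hcast : a + ((negRes 1 a + p * j : ℕ) : ℤ_[p]) = p * (dworkPrime a + j) := by
        push_cast
        linear_combination -hb
      have hA := multichoose_add_mul hl hb hl j
      rw [pochQuot, if_neg (lt_irrefl _), one_mul] at hA
      rw [hcast, sigma_apply, tPowMul_apply, hdiv hl, coeff_hyp, coeff_hyp, map_pow,
        frobenius_zpToW, hA, map_mul zpToW (Ring.multichoose _ _)]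
      linear_combination (-zpToW (Ring.multichoose (dworkPrime a) j) ^ s) * hqeq j
    · rw [sigma_apply_of_not_dvd _ _ hk, mul_zero, sub_zero]
      have := congrArg zpToW (Ring.mul_inverse_cancel _ ((isUnit_iff_not_dvd _).2 hk))
      rw [map_mul, map_one] at this
      linear_combination (-PowerSeries.coeff k (hyp s a)) * this

end

section

variable {p : ℕ} [Fact p.Prime]

/-! ### The hypergeometric series as a Dwork family -/

/-- Coefficients in ℤ_p are fixed by Frobenius mod p, so no twist appears. This is why `hPoly` is
descended from W to ℤ_p. -/
theorem p_dvd_pow_sub_expand (P : ℤ_[p][X]) :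
    (p : ℤ_[p][X]) ∣ P ^ p - Polynomial.expand ℤ_[p] p P := by
  rw [← map_natCast (C (R := ℤ_[p])), C_dvd_iff_dvd_coeff]
  intro i
  rw [← Ideal.mem_span_singleton, ← PadicInt.maximalIdeal_eq_span_p, ← PadicInt.ker_toZMod,
    RingHom.mem_ker, ← Polynomial.coeff_map, Polynomial.map_sub, Polynomial.map_pow,
    Polynomial.map_expand, ZMod.expand_card, sub_self, coeff_zero]

theorem exists_map_eq_hPoly (s r : ℕ) (a : ℤ_[p]) : ∃ P : ℤ_[p][X], P.map zpToW = hPoly s r a := by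
  refine ⟨∏ i ∈ Finset.range r, PowerSeries.trunc p (PowerSeries.mk fun k =>
    Ring.multichoose (dworkPrime^[i] a) k ^ s), ?_⟩
  rw [Polynomial.map_prod, hPoly]
  refine Finset.prod_congr rfl fun i _ => ?_
  ext k
  rw [Polynomial.coeff_map, PowerSeries.coeff_trunc, PowerSeries.coeff_trunc, coeff_hyp,
    PowerSeries.coeff_mk]
  split_ifs
  · rw [map_pow]
  · rw [map_zero]

theorem isDworkFamily_hyp (s : ℕ) {r : ℕ} (hr : 0 < r) {a : ℤ_[p]} (har : dworkPrime^[r] a = a) :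
    IsDworkFamily p (hPoly s r a)
      (fun i k => zpToW (Ring.multichoose (dworkPrime^[i] a) k) ^ s) where
  ne_zero := (Fact.out : p.Prime).ne_zero
  zero_right i := by rw [Ring.multichoose_zero_right, map_one, one_pow]
  expand_dvd := by
    obtain ⟨P, hP⟩ := exists_map_eq_hPoly s r a
    have := map_dvd (Polynomial.mapRingHom zpToW) (p_dvd_pow_sub_expand P)
    rwa [map_natCast, map_sub, map_pow, Polynomial.coe_mapRingHom, Polynomial.map_expand, hP]
      at this
  trunc_dvd i := by
    -- Periodicity lets the finite product h contain the truncations for all i.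
    have hper : dworkPrime^[i % r] a = dworkPrime^[i] a :=
      Function.IsPeriodicPt.iterate_mod_apply har i
    simp only [← hper]
    exact Finset.dvd_prod_of_mem (fun i => PowerSeries.trunc p (hyp s (dworkPrime^[i] a)))
      (Finset.mem_range.2 (Nat.mod_lt i hr))
  exists_quot i k hk := by
    obtain ⟨e, he, h⟩ := exists_multichoose_pow_quot s (negRes_one_lt (dworkPrime^[i] a))
      (p_mul_dworkPrime (dworkPrime^[i] a)) hk
    refine ⟨fun j => zpToW (e j), he.map zpToW, fun j => ?_⟩
    rw [Function.iterate_succ_apply']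
    have := congrArg zpToW (h j)
    rwa [map_mul, map_add, map_mul, map_pow, map_pow, map_pow, map_natCast] at this

/-- `hatF` has coefficients in `W`, and is rational modulo every power of `p`. -/
theorem exists_hatF (s : ℕ) {a : ℤ_[p]} (ha : ∀ n : ℕ, a ≠ -(n : ℤ_[p])) (u : W p) {r : ℕ}
    (hr : 0 < r) (har : dworkPrime^[r] a = a) : ∃ f : PowerSeries (W p),
      f.map (algebraMap (W p) (K p)) = hatF s a u ∧ ∀ n, f ∈ ratSubring p (hPoly s r a) n := by
  obtain ⟨q, hq, hqG⟩ := exists_padicUC_hatG s a ha u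
  have H := isDworkFamily_hyp s hr har
  refine ⟨_, ?_, fun n => H.ratio_mem n 0 q hq⟩
  have hmul := H.ratio_mul 0 q
  set f := IsDworkFamily.ratio
    (fun i k => zpToW (Ring.multichoose (dworkPrime^[i] a) k) ^ s) 0 q with hf
  have hmul' : f * hyp s a = PowerSeries.mk fun k => q k * PowerSeries.coeff k (hyp s a) := by
    simp only [coeff_hyp]
    exact hmul
  rw [hatF, PowerSeries.eq_mul_inv_iff_mul_eq, ← map_mul, hmul']
  · ext k
    rw [PowerSeries.coeff_map, PowerSeries.coeff_mk, hqG]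
  · rw [← PowerSeries.coeff_zero_eq_constantCoeff_apply, PowerSeries.coeff_map, coeff_hyp,
      Ring.multichoose_zero_right, map_one, one_pow, map_one]
    exact one_ne_zero

/-! ### Elements of the Tate ring -/

theorem expand_algebraMap (h : (W p)[X]) (hh : IsUnit (h.coeff 0)) (n : ℕ) (P : (Wmod p n)[X]) :
    expand h hh n (algebraMap _ (Level h n) P) = polyToLaurent _ P :=
  IsLocalization.Away.lift_eq (den h n) (isUnit_polyToLaurent_den h hh n) P

theorem trans_algebraMap (h : (W p)[X]) {m n : ℕ} (hmn : m ≤ n) (P : (Wmod p n)[X]) :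
    trans h hmn (algebraMap _ (Level h n) P) = algebraMap _ (Level h m) (P.map (red hmn)) :=
  IsLocalization.Away.lift_eq (den h n) _ P

theorem polyToLaurent_injective (R : Type) [CommRing R] :
    Function.Injective (polyToLaurent R) :=
  HahnSeries.ofPowerSeries_injective.comp (Polynomial.coe_injective R)

/-- The denominator expands to a unit, and a polynomial is determined by its Laurent series. This
gives both uniqueness and the compatibility of the levels. -/
theorem expand_injective (h : (W p)[X]) (hh : IsUnit (h.coeff 0)) (n : ℕ) :
    Function.Injective (expand h hh n) := by
  rw [injective_iff_map_eq_zero]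
  intro y hy
  obtain ⟨⟨P, d⟩, hP⟩ := IsLocalization.surj (Submonoid.powers (den h n)) y
  have h1 := congrArg (expand h hh n) hP
  rw [map_mul, hy, zero_mul, expand_algebraMap] at h1
  have h2 : P = 0 := polyToLaurent_injective _ (by rw [map_zero]; exact h1.symm)
  have h3 := IsLocalization.map_units (Level h n) d
  simp only [h2, map_zero] at hP
  exact h3.mul_left_eq_zero.1 hP

theorem polyToLaurent_map (n : ℕ) (P : (W p)[X]) :
    polyToLaurent (Wmod p n) (P.map (Ideal.Quotient.mk (Ideal.span {(p : W p) ^ n}))) =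
      HahnSeries.ofPowerSeries ℤ (Wmod p n)
        ((P : PowerSeries (W p)).map (Ideal.Quotient.mk (Ideal.span {(p : W p) ^ n}))) := by
  rw [polyToLaurent, RingHom.comp_apply, Polynomial.coeToPowerSeries.ringHom_apply,
    Polynomial.polynomial_map_coe]

theorem map_mk_eq_of_dvd_sub {n : ℕ} {f g : PowerSeries (W p)}
    (hfg : (p : PowerSeries (W p)) ^ n ∣ f - g) :
    f.map (Ideal.Quotient.mk (Ideal.span {(p : W p) ^ n})) =
      g.map (Ideal.Quotient.mk (Ideal.span {(p : W p) ^ n})) := by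
  rw [← sub_eq_zero, ← map_sub]
  obtain ⟨z, hz⟩ := hfg
  have h0 : (p : Wmod p n) ^ n = 0 := by
    rw [← map_natCast (Ideal.Quotient.mk (Ideal.span {(p : W p) ^ n})), ← map_pow]
    exact Ideal.Quotient.eq_zero_iff_mem.2 (Ideal.mem_span_singleton_self _)
  rw [hz, map_mul, map_pow, map_natCast, ← map_natCast (PowerSeries.C (R := Wmod p n)), ← map_pow,
    h0, map_zero, zero_mul]

/-- `den` is t h rather than h, so P / h^k is written as P t^k / (t h)^k. -/
theorem expand_eq_of_mul_eq (h : (W p)[X]) (hh : IsUnit (h.coeff 0)) {n k : ℕ}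
    {f : PowerSeries (W p)} {P : (W p)[X]}
    (hP : (p : PowerSeries (W p)) ^ n ∣ f * (h : PowerSeries (W p)) ^ k - P) {y : Level h n}
    (hy : y * algebraMap _ (Level h n) (den h n ^ k) = algebraMap _ (Level h n)
      ((P * X ^ k).map (Ideal.Quotient.mk (Ideal.span {(p : W p) ^ n})))) :
    expand h hh n y = HahnSeries.ofPowerSeries ℤ (Wmod p n)
      (f.map (Ideal.Quotient.mk (Ideal.span {(p : W p) ^ n}))) := by
  have h1 := congrArg (expand h hh n) hy
  rw [map_mul, expand_algebraMap, expand_algebraMap, map_pow, polyToLaurent_map] at h1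
  refine ((isUnit_polyToLaurent_den h hh n).pow k).mul_right_cancel ?_
  rw [h1, den, polyToLaurent_map, ← map_pow, ← map_pow, ← map_mul, ← map_mul]
  refine congrArg _ (map_mk_eq_of_dvd_sub ?_)
  rw [dvd_sub_comm]
  have := hP.mul_right (PowerSeries.X ^ k)
  convert this using 1
  push_cast
  ring

theorem existsUnique_hasExpansion (h : (W p)[X]) (hh : IsUnit (h.coeff 0)) {f : PowerSeries (W p)}
    (hf : ∀ n, f ∈ ratSubring p h n) : ∃! x : TateRing h, HasExpansion h hh x f := by
  choose P k hP using fun n => mem_ratSubring.1 (hf n)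
  have hy : ∀ n, ∃ y : Level h n, y * algebraMap _ (Level h n) (den h n ^ k n) =
      algebraMap _ (Level h n)
        ((P n * X ^ k n).map (Ideal.Quotient.mk (Ideal.span {(p : W p) ^ n}))) := by
    intro n
    obtain ⟨v, hv⟩ := ((IsLocalization.Away.algebraMap_isUnit (S := Level h n) (den h n)).pow
      (k n)).exists_left_inv
    exact ⟨algebraMap _ (Level h n)
      ((P n * X ^ k n).map (Ideal.Quotient.mk (Ideal.span {(p : W p) ^ n}))) * v, by
        rw [map_pow, mul_assoc, hv, mul_one]⟩
  choose y hy using hy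
  have hmem : y ∈ TateRing h := by
    intro m n hmn
    -- The fractions chosen at levels m and n need not match, but both expand to f mod p^m.
    refine expand_injective h hh m ?_
    rw [expand_eq_of_mul_eq h hh (hP m) (hy m)]
    refine expand_eq_of_mul_eq h hh (k := k n) (P := P n) ((pow_dvd_pow _ hmn).trans (hP n)) ?_
    have := congrArg (trans h hmn) (hy n)
    rw [map_mul, trans_algebraMap, trans_algebraMap, Polynomial.map_pow, map_den,
      Polynomial.map_map] at this
    exact this
  refine ⟨⟨y, hmem⟩, fun n => expand_eq_of_mul_eq h hh (hP n) (hy n), fun z hz => ?_⟩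
  refine Subtype.ext (funext fun n => expand_injective h hh n ?_)
  rw [hz n]
  exact (expand_eq_of_mul_eq h hh (hP n) (hy n)).symm

end

section

/-! ### Evaluation of power series on the open unit disc -/

variable {R L : Type*} [CommRing R] [NormedField L] {φ : R →+* L}

theorem norm_eval₂_le_one [IsUltrametricDist L] (hφ : ∀ w, ‖φ w‖ ≤ 1) {x : L} (hx : ‖x‖ ≤ 1)
    (P : R[X]) : ‖P.eval₂ φ x‖ ≤ 1 := by
  induction P using Polynomial.induction_on' with
  | add P Q hP hQ =>
    rw [Polynomial.eval₂_add]
    exact (IsUltrametricDist.norm_add_le_max _ _).trans (max_le hP hQ)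
  | monomial n a =>
    rw [Polynomial.eval₂_monomial, norm_mul, norm_pow]
    exact mul_le_one₀ (hφ a) (by positivity) (pow_le_one₀ (norm_nonneg _) hx)

/-- The unit constant term dominates, so the open disc lies in the region |h| = 1. -/
theorem norm_eval₂_eq_one [IsUltrametricDist L] (hφ : ∀ w, ‖φ w‖ ≤ 1) {x : L} (hx : ‖x‖ < 1)
    {P : R[X]} (hP : IsUnit (P.coeff 0)) : ‖P.eval₂ φ x‖ = 1 := by
  have h0 : ‖φ (P.coeff 0)‖ = 1 := by
    obtain ⟨v, hv⟩ := hP.exists_left_inv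
    have h1 := congrArg (fun y => ‖φ y‖) hv
    simp only [map_mul, map_one, norm_mul, norm_one] at h1
    refine le_antisymm (hφ _) ?_
    rw [← h1]
    exact mul_le_of_le_one_left (norm_nonneg _) (hφ v)
  have h1 : ‖(P.divX * X).eval₂ φ x‖ < 1 := by
    rw [Polynomial.eval₂_mul_X, norm_mul]
    exact (mul_le_of_le_one_left (norm_nonneg _) (norm_eval₂_le_one hφ hx.le _)).trans_lt hx
  rw [← Polynomial.divX_mul_X_add P, Polynomial.eval₂_add, Polynomial.eval₂_C,
    IsUltrametricDist.norm_add_eq_max_of_norm_ne_norm (by rw [h0]; exact h1.ne), h0,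
    max_eq_right h1.le]

theorem summable_norm_coeff_mul_pow (hφ : ∀ w, ‖φ w‖ ≤ 1) {x : L} (hx : ‖x‖ < 1)
    (f : PowerSeries R) : Summable fun k => ‖φ (PowerSeries.coeff k f) * x ^ k‖ := by
  refine Summable.of_nonneg_of_le (fun _ => norm_nonneg _) (fun k => ?_)
    (summable_geometric_of_lt_one (norm_nonneg x) hx)
  rw [norm_mul, norm_pow]
  exact mul_le_of_le_one_left (by positivity) (hφ _)

variable [CompleteSpace L]

/-- Evaluation of power series with bounded coefficients on the open unit disc. -/
def evalDisc (hφ : ∀ w, ‖φ w‖ ≤ 1) {x : L} (hx : ‖x‖ < 1) : PowerSeries R →+* L where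
  toFun f := ∑' k, φ (PowerSeries.coeff k f) * x ^ k
  map_one' := by
    rw [tsum_eq_single 0]
    · simp
    · intro k hk
      rw [PowerSeries.coeff_one, if_neg hk, map_zero, zero_mul]
  map_zero' := by simp
  map_add' f g := by
    rw [← Summable.tsum_add (summable_norm_coeff_mul_pow hφ hx f).of_norm
      (summable_norm_coeff_mul_pow hφ hx g).of_norm]
    simp only [map_add, add_mul]
  map_mul' f g := by
    rw [tsum_mul_tsum_eq_tsum_sum_antidiagonal_of_summable_norm
      (summable_norm_coeff_mul_pow hφ hx f) (summable_norm_coeff_mul_pow hφ hx g)]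
    refine tsum_congr fun n => ?_
    rw [PowerSeries.coeff_mul, map_sum, Finset.sum_mul]
    refine Finset.sum_congr rfl fun ij hij => ?_
    rw [← Finset.HasAntidiagonal.mem_antidiagonal.1 hij, map_mul, pow_add]
    ring

theorem hasSum_evalDisc (hφ : ∀ w, ‖φ w‖ ≤ 1) {x : L} (hx : ‖x‖ < 1) (f : PowerSeries R) :
    HasSum (fun k => φ (PowerSeries.coeff k f) * x ^ k) (evalDisc hφ hx f) :=
  (summable_norm_coeff_mul_pow hφ hx f).of_norm.hasSum

theorem evalDisc_coe (hφ : ∀ w, ‖φ w‖ ≤ 1) {x : L} (hx : ‖x‖ < 1) (P : R[X]) :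
    evalDisc hφ hx (P : PowerSeries R) = P.eval₂ φ x := by
  rw [Polynomial.eval₂_eq_sum_range]
  refine (hasSum_evalDisc hφ hx _).unique ?_
  simp only [Polynomial.coeff_coe]
  refine hasSum_sum_of_ne_finset_zero fun k hk => ?_
  rw [Polynomial.coeff_eq_zero_of_natDegree_lt, map_zero, zero_mul]
  rw [Finset.mem_range] at hk
  omega

theorem norm_evalDisc_le_one [IsUltrametricDist L] (hφ : ∀ w, ‖φ w‖ ≤ 1) {x : L} (hx : ‖x‖ < 1)
    (f : PowerSeries R) : ‖evalDisc hφ hx f‖ ≤ 1 := by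
  refine IsUltrametricDist.norm_tsum_le_of_forall_le_of_nonneg zero_le_one fun k => ?_
  rw [norm_mul, norm_pow]
  exact mul_le_one₀ (hφ _) (by positivity) (pow_le_one₀ (norm_nonneg _) hx.le)

theorem natCast_pow_dvd_of_coe_dvd {p n : ℕ} {P : R[X]}
    (hP : (p : PowerSeries R) ^ n ∣ (P : PowerSeries R)) : (p : R[X]) ^ n ∣ P := by
  obtain ⟨z, hz⟩ := hP
  rw [← map_natCast (C (R := R)), ← map_pow, C_dvd_iff_dvd_coeff]
  intro i
  refine ⟨PowerSeries.coeff i z, ?_⟩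
  rw [← Polynomial.coeff_coe, hz, ← map_natCast (PowerSeries.C (R := R)), ← map_pow,
    PowerSeries.coeff_C_mul]

/-- A power series that is rational modulo all powers of `p` extends to a uniform limit of rational
functions. -/
theorem exists_isKrasnerAnalyticOn {L : Type} [NormedField L] [CompleteSpace L]
    [IsUltrametricDist L] {φ : R →+* L} {p : ℕ} (hp : ‖(p : L)‖ < 1) (hφ : ∀ w, ‖φ w‖ ≤ 1)
    {h : R[X]} (hh : IsUnit (h.coeff 0)) {f : PowerSeries R} (hf : ∀ n, f ∈ ratSubring p h n) :
    ∃ g : L → L, IsKrasnerAnalyticOn g {x | ‖x‖ ≤ 1 ∧ ‖h.eval₂ φ x‖ = 1} ∧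
      ∀ x : L, ‖x‖ < 1 → HasSum (fun k => φ (PowerSeries.coeff k f) * x ^ k) (g x) := by
  classical
  choose P k hP using fun n => mem_ratSubring.1 (hf n)
  set Q : ℕ → L → L := fun n x => (P n).eval₂ φ x / h.eval₂ φ x ^ k n with hQ
  have hQQ : ∀ x : L, ‖x‖ ≤ 1 → ‖h.eval₂ φ x‖ = 1 → ∀ m n, m ≤ n →
      ‖Q n x - Q m x‖ ≤ ‖(p : L)‖ ^ m := by
    intro x hx hhx m n hmn
    -- Both fractions approximate f mod p^m. The cross difference is a polynomial, so the
    -- divisibility descends from power series and can be used on all of |x| ≤ 1.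
    have hdvd : (p : R[X]) ^ m ∣ P n * h ^ k m - P m * h ^ k n := by
      refine natCast_pow_dvd_of_coe_dvd ?_
      have := dvd_sub ((hP m).mul_right ((h : PowerSeries R) ^ k n))
        (((pow_dvd_pow _ hmn).trans (hP n)).mul_right ((h : PowerSeries R) ^ k m))
      convert this using 1
      push_cast
      ring
    obtain ⟨Z, hZ⟩ := hdvd
    have hZ' := congrArg (Polynomial.eval₂ φ x) hZ
    simp only [Polynomial.eval₂_sub, Polynomial.eval₂_mul, Polynomial.eval₂_pow,
      Polynomial.eval₂_natCast] at hZ'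
    have hne : h.eval₂ φ x ≠ 0 := norm_ne_zero_iff.1 (by rw [hhx]; exact one_ne_zero)
    rw [hQ]
    beta_reduce
    rw [div_sub_div _ _ (pow_ne_zero _ hne) (pow_ne_zero _ hne), mul_comm (h.eval₂ φ x ^ k n), hZ',
      norm_div, norm_mul, norm_mul, norm_pow, norm_pow, norm_pow, hhx, one_pow, one_pow, mul_one,
      div_one]
    exact mul_le_of_le_one_right (by positivity) (norm_eval₂_le_one hφ hx Z)
  have hdisc : ∀ x : L, ∀ hx : ‖x‖ < 1, ∀ n, ‖evalDisc hφ hx f - Q n x‖ ≤ ‖(p : L)‖ ^ n := by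
    intro x hx n
    have hhx := norm_eval₂_eq_one hφ hx hh
    have hne : h.eval₂ φ x ≠ 0 := norm_ne_zero_iff.1 (by rw [hhx]; exact one_ne_zero)
    obtain ⟨z, hz⟩ := hP n
    have hz' := congrArg (evalDisc hφ hx) hz
    rw [map_sub, map_mul, map_mul, map_pow, map_pow, map_natCast, evalDisc_coe, evalDisc_coe] at hz'
    rw [hQ]
    beta_reduce
    rw [sub_div' (pow_ne_zero _ hne), hz', norm_div, norm_mul, norm_pow, norm_pow, hhx, one_pow,
      div_one]
    exact mul_le_of_le_one_right (by positivity) (norm_evalDisc_le_one hφ hx z)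
  have htend : Filter.Tendsto (fun n => ‖(p : L)‖ ^ n) Filter.atTop (nhds 0) :=
    tendsto_pow_atTop_nhds_zero_of_lt_one (norm_nonneg _) hp
  have hlim : ∀ x : L, ‖x‖ ≤ 1 → ‖h.eval₂ φ x‖ = 1 → ∃ y, ∀ n, ‖y - Q n x‖ ≤ ‖(p : L)‖ ^ n := by
    intro x hx hhx
    have hcau : CauchySeq fun n => Q n x := by
      refine cauchySeq_of_le_tendsto_0' _ (fun m n hmn => ?_) htend
      rw [dist_comm, dist_eq_norm]
      exact hQQ x hx hhx m n hmn
    obtain ⟨y, hy⟩ := cauchySeq_tendsto_of_complete hcau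
    refine ⟨y, fun m => le_of_tendsto (hy.sub_const (Q m x)).norm ?_⟩
    filter_upwards [Filter.eventually_ge_atTop m] with n hn
    exact hQQ x hx hhx m n hn
  -- The value is the sum of the series on the open disc, the limit of the fractions on the rest of
  -- the domain, and 0 elsewhere.
  have hg : ∀ x : L, ∃ y, (∀ hx : ‖x‖ < 1, y = evalDisc hφ hx f) ∧
      (‖x‖ ≤ 1 → ‖h.eval₂ φ x‖ = 1 → ∀ n, ‖y - Q n x‖ ≤ ‖(p : L)‖ ^ n) := by
    intro x
    by_cases hx : ‖x‖ < 1
    · exact ⟨evalDisc hφ hx f, fun _ => rfl, fun _ _ => hdisc x hx⟩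
    · by_cases hD : ‖x‖ ≤ 1 ∧ ‖h.eval₂ φ x‖ = 1
      · obtain ⟨y, hy⟩ := hlim x hD.1 hD.2
        exact ⟨y, fun h => absurd h hx, fun _ _ => hy⟩
      · exact ⟨0, fun h => absurd h hx, fun h1 h2 => absurd ⟨h1, h2⟩ hD⟩
  choose g hg1 hg2 using hg
  refine ⟨g, fun ε hε => ?_, fun x hx => hg1 x hx ▸ hasSum_evalDisc hφ hx f⟩
  obtain ⟨n, hn⟩ := (htend.eventually (ge_mem_nhds hε)).exists
  refine ⟨(P n).map φ, (h ^ k n).map φ, fun x hx => ?_, fun x hx => ?_⟩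
  · rw [Polynomial.eval_map, Polynomial.eval₂_pow]
    exact pow_ne_zero _ (norm_ne_zero_iff.1 (by rw [hx.2]; exact one_ne_zero))
  · rw [Polynomial.eval_map, Polynomial.eval_map, Polynomial.eval₂_pow]
    exact (hg2 x hx.1 hx.2 n).trans hn

theorem norm_natCast_padicComplex_lt_one (p : ℕ) [Fact p.Prime] : ‖(p : ℂ_[p])‖ < 1 := by
  have := PadicComplex.norm_extends' (p := p) (p : ℚ_[p])
  rw [← PadicComplex.coe_natCast, ← map_natCast (algebraMap ℚ_[p] (PadicAlgCl p))]
  rw [this]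
  exact Padic.norm_p_lt_one

end
end HatHG
end

/-! ### The theorem -/

open HatHG in
theorem corollary3p2 (p : ℕ) [Fact p.Prime] (s : ℕ) (hs : 0 < s)
    (a : ℤ_[p]) (ha : ∀ n : ℕ, a ≠ -(n : ℤ_[p]))
    (u : W p) -- `σ(t) = c t ^ p` with `c = 1 + p u`
    (r : ℕ) (hr : 0 < r) (har : dworkPrime^[r] a = a) :
    ∃ f : PowerSeries (W p),
      f.map (algebraMap (W p) (K p)) = hatF s a u ∧
      (∃! x : TateRing (hPoly s r a),
        HasExpansion (hPoly s r a) (hPoly_coeff_zero s r a) x f) ∧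
      ∀ φ : W p →+* ℂ_[p], (∀ w, ‖φ w‖ ≤ 1) →
        ∃ g : ℂ_[p] → ℂ_[p],
          IsKrasnerAnalyticOn g {x | ‖x‖ ≤ 1 ∧ ‖(hPoly s r a).eval₂ φ x‖ = 1} ∧
          ∀ x : ℂ_[p], ‖x‖ < 1 → HasSum (fun k => φ (PowerSeries.coeff k f) * x ^ k) (g x) := by
  obtain ⟨f, hfF, hf⟩ := exists_hatF s ha u hr har
  exact ⟨f, hfF, existsUnique_hasExpansion _ _ hf, fun φ hφ =>
    exists_isKrasnerAnalyticOn (norm_natCast_padicComplex_lt_one p) hφ (hPoly_coeff_zero s r a) hf⟩
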